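/- **Setting.** Let $(V,\sigma)$ be a 4-dimensional complex symplectic vector space. A *curve* $Z\subset\mathbb P V\cong\mathbb P^3$ is a (not necessarily closed) 1-dimensional complex submanifold; its affine cone $\widehat Z\subset V$ is the union of the lines $\widehat z=\mathbb C z$ with $[z]\in Z$, and $T_z\widehat Z$ denotes the tangent space of $\widehat Z$ at $z\in\widehat Z\setminus 0$. The curve $Z$ is *Legendrian* if $\sigma(T_z\widehat Z,T_z\widehat Z)=0$ for all $z\in\widehat Z\setminus 0$. Put $T^{(1)}_z\widehat Z=T_z\widehat Z$, and let $T^{(i+1)}_z\widehat Z$ be spanned by $T^{(i)}_z\widehat Z$ and all $\gamma^{(i+1)}(0)$, where $\gamma$ is a holomorphic curve in $\widehat Z$ with $\gamma(0)=z$. The point $[z]$ is a *nondegenerate point* of $Z$ if $T^{(k)}_z\widehat Z=V$ for some $k\ge 1$; the germ of $Z$ at $[z]$ is *nondegenerate* if every neighborhood of $[z]$ in $Z$ contains a nondegenerate point of $Z$. Let $$\mathfrak{csp}(V)=\{u\in\mathfrak{gl}(V)\mid \exists\, c\in\mathbb C\ \ \forall v,w\in V:\ \sigma(uv,w)+\sigma(v,uw)=c\,\sigma(v,w)\},$$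 and let $\mathfrak{aut}(Z)$, for the germ of $Z$ at a point, be the Lie algebra of all $u\in\mathfrak{csp}(V)$ such that $u(v)\in T_v\widehat Z$ for all nonzero $v$ in the affine cone over some neighborhood of that point in $Z$ (it contains $\mathbb C\,\mathrm{Id}_V$). Let $\mathbf Z=\{[a^3:a^2b:ab^2:b^3]\mid (a,b)\in\mathbb C^2\setminus 0\}\subset\mathbb P^3$ be the rational normal curve, which is Legendrian with respect to the symplectic form $\sigma_0=\theta^1\wedge\theta^4-3\,\theta^2\wedge\theta^3$ on $\mathbb C^4$, where $\theta^1,\dots,\theta^4$ are the coordinates. **Proposition 7.2.** Let $Z\subset\mathbb P V\cong\mathbb P^3$ be a germ of a nondegenerate Legendrian curve with $\dim_{\mathbb C}\mathfrak{aut}(Z)\ge 3$. Then $Z$ is isomorphic to a germ of the rational normal curve $\mathbf Z$, that is, there is a linear isomorphism $f:V\to\mathbb C^4$ with $\sigma_0(f(v),f(w))=\sigma(v,w)$ for all $v,w\in V$ that maps the germ $Z$ onto the germ of $\mathbf Z$ at the image point; and $\dim_{\mathbb C}\mathfrak{aut}(Z)=4$. -/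

import Mathlib

open Filter Topology
open scoped LinearAlgebra.Projectivization

noncomputable section

namespace LegendrianCurve

variable {V : Type*} [NormedAddCommGroup V] [NormedSpace ℂ V]

/-- The affine cone of a subset of projective space: the union of the lines `[z] ∈ Z`. -/
def affineCone (Z : Set (ℙ ℂ V)) : Set V :=
  {v | ∃ p ∈ Z, v ∈ p.submodule}

/-- `γ` is (the germ at `0` of) a holomorphic curve in `C` with `γ 0 = z`. -/
def IsArcIn (C : Set V) (z : V) (γ : ℂ → V) : Prop :=
  AnalyticAt ℂ γ 0 ∧ γ 0 = z ∧ ∀ᶠ t in 𝓝 (0 : ℂ), γ t ∈ C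

/-- `Z` is a curve: a (not necessarily closed) one-dimensional complex submanifold of `ℙ V`.
Around each of its points `Z` has a local holomorphic parametrization `t ↦ [c t]`, which is an
immersion into `ℙ V` (`c 0` and `c' 0` are linearly independent), which takes its values in `Z`,
and which maps arbitrarily small neighbourhoods of `0` onto neighbourhoods of `[c 0]` in `Z`.
Neighbourhoods of `[z]` in `ℙ V` are the images of the neighbourhoods of `z` in `V`. -/
def IsCurve (Z : Set (ℙ ℂ V)) : Prop :=
  ∀ z ∈ affineCone Z, z ≠ 0 → ∃ c : ℂ → V,
    IsArcIn (affineCone Z) z c ∧ LinearIndependent ℂ ![c 0, deriv c 0] ∧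
    ∀ U ∈ 𝓝 (0 : ℂ), ∀ᶠ v in 𝓝 z, v ∈ affineCone Z → ∃ t ∈ U, ∃ s : ℂ, v = s • c t

/-- The tangent space at `z` of a submanifold `C` of `V`, spanned by the velocities of the
holomorphic curves in `C` through `z`. -/
def tangentSpace (C : Set V) (z : V) : Submodule ℂ V :=
  Submodule.span ℂ {w | ∃ γ : ℂ → V, IsArcIn C z γ ∧ w = deriv γ 0}

/-- The osculating sequence of `C` at `z`: the line spanned by `z`, then the tangent space, then
the higher osculating spaces. -/
def osculatingSpace (C : Set V) (z : V) : ℕ → Submodule ℂ V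
  | 0 => Submodule.span ℂ {z}
  | 1 => tangentSpace C z
  | k + 2 => osculatingSpace C z (k + 1) ⊔
      Submodule.span ℂ {w | ∃ γ : ℂ → V, IsArcIn C z γ ∧ w = iteratedDeriv (k + 2) γ 0}

/-- `[z]` is a nondegenerate point of `Z`. -/
def IsNondegeneratePoint (Z : Set (ℙ ℂ V)) (z : V) : Prop :=
  z ∈ affineCone Z ∧ z ≠ 0 ∧ ∃ k ≥ 1, osculatingSpace (affineCone Z) z k = ⊤

/-- The germ of `Z` at `[z]` is nondegenerate: every neighbourhood of `[z]` in `Z` has a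
nondegenerate point (which need not be `[z]` itself). -/
def IsNondegenerateGerm (Z : Set (ℙ ℂ V)) (z : V) : Prop :=
  ∃ᶠ v in 𝓝 z, IsNondegeneratePoint Z v

/-- `Z` is Legendrian with respect to `σ`. -/
def IsLegendrian (σ : LinearMap.BilinForm ℂ V) (Z : Set (ℙ ℂ V)) : Prop :=
  ∀ z ∈ affineCone Z, z ≠ 0 →
    ∀ v ∈ tangentSpace (affineCone Z) z, ∀ w ∈ tangentSpace (affineCone Z) z, σ v w = 0

/-- The conformal symplectic algebra `csp(V)` of `σ`. -/
def csp (σ : LinearMap.BilinForm ℂ V) : Submodule ℂ (Module.End ℂ V) where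
  carrier := {u | ∃ c : ℂ, ∀ v w, σ (u v) w + σ v (u w) = c * σ v w}
  add_mem' := by
    rintro a b ⟨c, hc⟩ ⟨d, hd⟩
    refine ⟨c + d, fun v w => ?_⟩
    simp only [LinearMap.add_apply, map_add]
    linear_combination hc v w + hd v w
  zero_mem' := ⟨0, fun v w => by simp⟩
  smul_mem' := by
    rintro r a ⟨c, hc⟩
    refine ⟨r * c, fun v w => ?_⟩
    simp only [LinearMap.smul_apply, map_smul, smul_eq_mul]
    linear_combination r * hc v w

/-- The Lie algebra `aut` of the germ of `Z` at `[z]`: the elements `u` of `csp(V)` with `u v`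
tangent to the affine cone of `Z` at `v`, for all `v` in the cone over a neighbourhood of `[z]`
in `Z`. -/
def autGerm (σ : LinearMap.BilinForm ℂ V) (Z : Set (ℙ ℂ V)) (z : V) :
    Submodule ℂ (Module.End ℂ V) where
  carrier := {u | u ∈ csp σ ∧
    ∀ᶠ v in 𝓝 z, v ∈ affineCone Z → u v ∈ tangentSpace (affineCone Z) v}
  add_mem' := by
    rintro a b ⟨ha, ha'⟩ ⟨hb, hb'⟩
    refine ⟨add_mem ha hb, ?_⟩
    filter_upwards [ha', hb'] with v h1 h2 hv
    exact add_mem (h1 hv) (h2 hv)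
  zero_mem' := ⟨zero_mem _, Eventually.of_forall fun v _ => zero_mem _⟩
  smul_mem' := by
    rintro r a ⟨ha, ha'⟩
    refine ⟨Submodule.smul_mem _ r ha, ?_⟩
    filter_upwards [ha'] with v h1 hv
    exact Submodule.smul_mem _ r (h1 hv)

/-- The cube `w³` of `w = a x + b y`, in the basis `x³, 3x²y, 3xy², y³` of `Sym³ ℂ²`. -/
def cube (a b : ℂ) : Fin 4 → ℂ :=
  ![a ^ 3, a ^ 2 * b, a * b ^ 2, b ^ 3]

/-- The rational normal curve in `ℙ³ = ℙ(Sym³ ℂ²)`. -/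
def rationalNormalCurve : Set (ℙ ℂ (Fin 4 → ℂ)) :=
  {p | ∃ (a b : ℂ) (h : cube a b ≠ 0), p = Projectivization.mk ℂ (cube a b) h}

/-- The symplectic form `θ¹ ∧ θ⁴ - 3 θ² ∧ θ³` on `Sym³ ℂ²`, up to a scalar the only one for which
the rational normal curve is Legendrian. -/
def cubicForm : LinearMap.BilinForm ℂ (Fin 4 → ℂ) :=
  LinearMap.mk₂ ℂ
    (fun v w => (v 0 * w 3 - v 3 * w 0) - 3 * (v 1 * w 2 - v 2 * w 1))
    (by intro v v' w; simp only [Pi.add_apply]; ring)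
    (by intro c v w; simp only [Pi.smul_apply, smul_eq_mul]; ring)
    (by intro v w w'; simp only [Pi.add_apply]; ring)
    (by intro c v w; simp only [Pi.smul_apply, smul_eq_mul]; ring)

end LegendrianCurve

end

/-!
The elements of `aut` act on a curve `Z` through vector fields, and a nondegenerate Legendrian
curve spans `V`, so that only scalars act trivially (`eq_smul_one_of_inducedField_eq_zero`). If
`aut` has dimension at least `3`, two of these vector fields are linearly independent; their
Wronskian is then nonzero at a general point `p` near `[z]`, and some `u` in `aut` induces a vector
field `f ∂ₜ` with a simple zero at `p` (`exists_simple_zero`). The point `p` can be taken where the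
osculating flag is complete.

Differentiating `u c = g c + f c'`, with `f(p) = 0` and `f'(p) = 1`, shows that `u` has
the eigenvalues `g(p)`, `g(p) + 1`, `g(p) + 2`, `g(p) + 3` (`exists_eigenbasis`). The coordinates
`hᵢ` of `c` in an eigenbasis solve `f hᵢ' = (g(p) + i - g) hᵢ`. A solution of such an equation is
determined, up to a factor, by its exponent at `p`, so that after scaling `hᵢ hⱼ = hₖ hₘ` whenever
`i + j = k + m` (`coord_mul_coord_eq`). These are the equations of the twisted cubic; by
analytic continuation they hold from `p` back to `[z]`. The eigenvalues also make the symplectic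
form antidiagonal in the eigenbasis (`exists_antidiagonal`), and the Legendrian condition fixes the
ratio of its two entries (`eq_neg_three_mul`), so that it is a multiple of `cubicForm`.

An immersed curve in the cone over the twisted cubic is open in it, which gives the equality of
germs (`eventually_mem_affineCone_iff`). A matrix that is tangent to the twisted cubic along an open
piece satisfies polynomial identities that force it into `gl₂` (`exists_eq_cubicAction`), which
has dimension `4`.

All local computations take place in a chart (`IsGraphChart`) in which the curve is a graph over
one of its affine coordinates, so that `g` and `f` are themselves coordinates of `u c`.
-/

noncomputable section

namespace LegendrianCurve

variable {V : Type*} [NormedAddCommGroup V] [NormedSpace ℂ V]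

/-! ### Orders of vanishing of solutions of `f Q' = m Q` -/

theorem eq_zero_of_eventually_pow_mul {E : ℂ → ℂ} {p : ℂ} (n : ℕ) (hE : ContinuousAt E p)
    (h : ∀ᶠ t in 𝓝 p, (t - p) ^ n * E t = 0) : E p = 0 := by
  have h1 : Tendsto E (𝓝[≠] p) (𝓝 (E p)) := hE.tendsto.mono_left nhdsWithin_le_nhds
  have h2 : Tendsto E (𝓝[≠] p) (𝓝 0) := by
    refine tendsto_const_nhds.congr' ?_
    filter_upwards [h.filter_mono nhdsWithin_le_nhds, self_mem_nhdsWithin] with t ht htp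
    exact ((mul_eq_zero.1 ht).resolve_left (pow_ne_zero _ (sub_ne_zero.2 htp))).symm
  exact tendsto_nhds_unique h1 h2

theorem hasDerivAt_pow_sub_mul {R : ℂ → ℂ} {p t : ℂ} (n : ℕ) (hR : DifferentiableAt ℂ R t) :
    HasDerivAt (fun t => (t - p) ^ n * R t)
      (n * (t - p) ^ (n - 1) * R t + (t - p) ^ n * deriv R t) t := by
  have h1 : HasDerivAt (fun t : ℂ => (t - p) ^ n) (n * (t - p) ^ (n - 1)) t := by
    simpa using ((hasDerivAt_id' t).sub_const p).fun_pow n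
  exact h1.fun_mul hR.hasDerivAt

/-- The indicial equation of the singular differential equation `f Q' = m Q`, where `f` vanishes
at `p`: a solution that vanishes to order exactly `n` at `p` has `n f'(p) = m(p)`. -/
theorem natCast_mul_deriv_eq_of_mul_deriv_eq {f m Q R : ℂ → ℂ} {p : ℂ} {n : ℕ}
    (hf : AnalyticAt ℂ f p) (hm : ContinuousAt m p) (hR : AnalyticAt ℂ R p) (hRp : R p ≠ 0)
    (hQ : ∀ᶠ t in 𝓝 p, Q t = (t - p) ^ n * R t) (hfp : f p = 0)
    (h : ∀ᶠ t in 𝓝 p, f t * deriv Q t = m t * Q t) : n * deriv f p = m p := by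
  have key := eq_zero_of_eventually_pow_mul (p := p)
    (E := fun t => dslope f p t * (n * R t + (t - p) * deriv R t) - m t * R t) n ?_ ?_
  rotate_left
  · have h1 : ContinuousAt (dslope f p) p :=
      continuousAt_dslope_same.2 hf.differentiableAt
    have h2 := hR.continuousAt
    have h3 := hR.deriv.continuousAt
    fun_prop
  · filter_upwards [hQ.eventually_nhds, h, hR.eventually_analyticAt] with t ht hft hRt
    have hd : deriv Q t = _ :=
      (EventuallyEq.deriv_eq ht).trans (hasDerivAt_pow_sub_mul n hRt.differentiableAt).deriv
    have hfs : f t = (t - p) * dslope f p t := by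
      have := sub_smul_dslope f p t
      rw [hfp, sub_zero, smul_eq_mul] at this
      exact this.symm
    rw [hd, ht.self_of_nhds, hfs] at hft
    rcases n with _ | n
    · simp only [pow_zero, Nat.cast_zero] at hft ⊢
      linear_combination hft
    · simp only [Nat.add_sub_cancel] at hft
      linear_combination hft
  simp only [dslope_same, sub_self, zero_mul, add_zero] at key
  have : (n * deriv f p - m p) * R p = 0 := by linear_combination key
  exact sub_eq_zero.1 ((mul_eq_zero.1 this).resolve_right hRp)

/-- A solution of `f Q' = m Q` with `m(p) = n f'(p)` that vanishes at `p` to an order greater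
than `n` is zero. -/
theorem eventually_eq_zero_of_mul_deriv_eq {f m Q R : ℂ → ℂ} {p : ℂ} {n : ℕ}
    (hf : AnalyticAt ℂ f p) (hm : ContinuousAt m p) (hR : AnalyticAt ℂ R p) (hRp : R p = 0)
    (hQ : ∀ᶠ t in 𝓝 p, Q t = (t - p) ^ n * R t) (hfp : f p = 0) (hf' : deriv f p ≠ 0)
    (hmn : m p = n * deriv f p)
    (h : ∀ᶠ t in 𝓝 p, f t * deriv Q t = m t * Q t) : ∀ᶠ t in 𝓝 p, Q t = 0 := by
  by_contra hne
  have hQa : AnalyticAt ℂ Q p :=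
    (((analyticAt_id.sub analyticAt_const).pow n).mul hR).congr (hQ.mono fun t ht => ht.symm)
  obtain ⟨k, S, hS, hSp, hQS⟩ := hQa.exists_eventuallyEq_pow_smul_nonzero_iff.2 hne
  have hk : k = n := by
    have := natCast_mul_deriv_eq_of_mul_deriv_eq hf hm hS hSp (by simpa using hQS) hfp h
    rw [hmn] at this
    exact_mod_cast mul_right_cancel₀ hf' this
  subst hk
  have : (fun t => S t - R t) p = 0 := by
    refine eq_zero_of_eventually_pow_mul (p := p) k (hS.fun_sub hR).continuousAt ?_
    filter_upwards [hQ, hQS] with t h1 h2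
    rw [smul_eq_mul] at h2
    linear_combination h1 - h2
  simp only [hRp, sub_zero] at this
  exact hSp this

/-- Two analytic functions with vanishing Wronskian are linearly dependent. -/
theorem eventually_eq_mul_of_wronskian_eq_zero {f g : ℂ → ℂ} {q : ℂ} (hf : AnalyticAt ℂ f q)
    (hg : AnalyticAt ℂ g q) (hq : f q ≠ 0)
    (h : ∀ᶠ t in 𝓝 q, f t * deriv g t - deriv f t * g t = 0) :
    ∀ᶠ t in 𝓝 q, g t = g q / f q * f t := by
  by_contra hne
  set k := g q / f q
  have hG : AnalyticAt ℂ (fun t => g t - k * f t) q := hg.sub (analyticAt_const.mul hf)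
  obtain ⟨n, S, hS, hSq, hGS⟩ := hG.exists_eventuallyEq_pow_smul_nonzero_iff.2
    (fun h0 => hne (h0.mono fun t ht => sub_eq_zero.1 ht))
  -- Multiplying `f G' = f' G` by `t - q` makes `q` a singular point with exponent `0`.
  have hlin : AnalyticAt ℂ (fun t : ℂ => t - q) q := analyticAt_id.sub analyticAt_const
  have h1 := natCast_mul_deriv_eq_of_mul_deriv_eq (f := fun t => (t - q) * f t)
    (m := fun t => (t - q) * deriv f t) (Q := fun t => g t - k * f t) (hlin.mul hf)
    (hlin.mul hf.deriv).continuousAt hS hSq (by simpa using hGS) (by simp) (by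
      filter_upwards [h, hf.eventually_analyticAt, hg.eventually_analyticAt] with t ht hft hgt
      have : deriv (fun t => g t - k * f t) t = deriv g t - k * deriv f t :=
        (hgt.differentiableAt.hasDerivAt.sub
          (hft.differentiableAt.hasDerivAt.const_mul k)).deriv
      rw [this]
      linear_combination (t - q) * ht)
  have h2 : deriv (fun t => (t - q) * f t) q = f q := by
    simpa using (((hasDerivAt_id' q).sub_const q).fun_mul hf.differentiableAt.hasDerivAt).deriv
  simp only [h2, sub_self, zero_mul, mul_eq_zero, hq, or_false, Nat.cast_eq_zero] at h1
  subst h1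
  have := hGS.self_of_nhds
  simp only [k, sub_self, pow_zero, one_smul, div_mul_cancel₀ _ hq] at this
  exact hSq this.symm

/-! ### Graph charts and tangent spaces -/

theorem smul_mem_affineCone {Z : Set (ℙ ℂ V)} {v : V} (hv : v ∈ affineCone Z) (s : ℂ) :
    s • v ∈ affineCone Z := by
  obtain ⟨p, hp, hvp⟩ := hv
  exact ⟨p, hp, p.submodule.smul_mem s hvp⟩

/-- A parametrization `t ↦ [c t]` of `Z` near `[z]` as a graph over an affine coordinate: in the
affine chart `θ₀ = 1` of the projective space, `c` is a holomorphic curve on a disc whose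
parameter is the coordinate `θ₁`. Every point `v` of the affine cone near `z` is then the point
of parameter `θ₁ v / θ₀ v`, up to the factor `θ₀ v`. -/
structure IsGraphChart (Z : Set (ℙ ℂ V)) (z : V) (θ₀ θ₁ : V →L[ℂ] ℂ) (c : ℂ → V) (r : ℝ) :
    Prop where
  pos : 0 < r
  analytic : AnalyticOnNhd ℂ c (Metric.ball 0 r)
  fst : ∀ t ∈ Metric.ball (0 : ℂ) r, θ₀ (c t) = 1
  snd : ∀ t ∈ Metric.ball (0 : ℂ) r, θ₁ (c t) = t
  mem : ∀ t ∈ Metric.ball (0 : ℂ) r, c t ∈ affineCone Z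
  curve_zero : c 0 = z
  repr : ∀ᶠ v in 𝓝 z, v ∈ affineCone Z → v = θ₀ v • c (θ₁ v / θ₀ v)

theorem exists_isGraphChart [FiniteDimensional ℂ V] {Z : Set (ℙ ℂ V)} (hZ : IsCurve Z) {z : V}
    (hz : z ∈ affineCone Z) (hz0 : z ≠ 0) :
    ∃ θ₀ θ₁ c r, IsGraphChart Z z θ₀ θ₁ c r := by
  obtain ⟨c₀, ⟨hc, hc0, hcC⟩, hli, hU⟩ := hZ z hz hz0
  obtain ⟨g, hg⟩ := LinearMap.exists_leftInverse_of_injective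
    (Fintype.linearCombination ℂ ![c₀ 0, deriv c₀ 0])
    (LinearMap.ker_eq_bot.2 (linearIndependent_iff_injective_fintypeLinearCombination.1 hli))
  let θ₀ : V →L[ℂ] ℂ := LinearMap.toContinuousLinearMap (LinearMap.proj 0 ∘ₗ g)
  let θ₁ : V →L[ℂ] ℂ := LinearMap.toContinuousLinearMap (LinearMap.proj 1 ∘ₗ g)
  have hg0 : g (c₀ 0) = Pi.single 0 1 := by
    simpa [Fintype.linearCombination_apply] using LinearMap.congr_fun hg (Pi.single 0 1)
  have hg1 : g (deriv c₀ 0) = Pi.single 1 1 := by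
    simpa [Fintype.linearCombination_apply] using LinearMap.congr_fun hg (Pi.single 1 1)
  have h00 : θ₀ (c₀ 0) = 1 := by simp [θ₀, hg0]
  have h10 : θ₁ (c₀ 0) = 0 := by simp [θ₁, hg0]
  have h11 : θ₁ (deriv c₀ 0) = 1 := by simp [θ₁, hg1]
  have ha : AnalyticAt ℂ (fun t => θ₀ (c₀ t)) 0 := (θ₀.analyticAt _).comp hc
  have hb : AnalyticAt ℂ (fun t => θ₁ (c₀ t)) 0 := (θ₁.analyticAt _).comp hc
  have ha0 : ∀ᶠ t in 𝓝 (0 : ℂ), θ₀ (c₀ t) ≠ 0 :=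
    ha.continuousAt.eventually_ne (by rw [h00]; exact one_ne_zero)
  let X : ℂ → ℂ := fun t => θ₁ (c₀ t) / θ₀ (c₀ t)
  have hX : AnalyticAt ℂ X 0 := hb.div ha (by rw [h00]; exact one_ne_zero)
  have hX0 : X 0 = 0 := by simp [X, h10]
  have hX' : deriv X 0 ≠ 0 := by
    have e0 : HasDerivAt (fun t => θ₀ (c₀ t)) (θ₀ (deriv c₀ 0)) 0 :=
      θ₀.hasFDerivAt.comp_hasDerivAt (0 : ℂ) hc.differentiableAt.hasDerivAt
    have e1 : HasDerivAt (fun t => θ₁ (c₀ t)) (θ₁ (deriv c₀ 0)) 0 :=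
      θ₁.hasFDerivAt.comp_hasDerivAt (0 : ℂ) hc.differentiableAt.hasDerivAt
    have := (e1.fun_div e0 (by rw [h00]; exact one_ne_zero)).deriv
    rw [h00, h10, h11] at this
    simp only [X, this]
    norm_num
  -- Reparametrize by the affine coordinate `X = θ₁ / θ₀`.
  let ψ : ℂ → ℂ := hX.hasStrictDerivAt.localInverse _ _ _ hX'
  have hψ : AnalyticAt ℂ ψ 0 := by
    have := hX.analyticAt_localInverse hX'
    rwa [hX0] at this
  have hψl : ∀ᶠ t in 𝓝 (0 : ℂ), ψ (X t) = t := hX.hasStrictDerivAt.eventually_left_inverse hX'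
  have hψr : ∀ᶠ x in 𝓝 (0 : ℂ), X (ψ x) = x := by
    have := hX.hasStrictDerivAt.eventually_right_inverse hX'
    rwa [hX0] at this
  have hψ0 : ψ 0 = 0 := by
    have := hψl.self_of_nhds
    rwa [hX0] at this
  have hψt : Tendsto ψ (𝓝 0) (𝓝 0) := by
    have := hψ.continuousAt.tendsto
    rwa [hψ0] at this
  let c : ℂ → V := fun x => (θ₀ (c₀ (ψ x)))⁻¹ • c₀ (ψ x)
  have hca : AnalyticAt ℂ c 0 := by
    have h1 : AnalyticAt ℂ (fun x => c₀ (ψ x)) 0 :=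
      AnalyticAt.comp (g := c₀) (by rwa [hψ0]) hψ
    have h2 : AnalyticAt ℂ (fun x => θ₀ (c₀ (ψ x))) 0 := (θ₀.analyticAt _).comp h1
    exact (h2.inv (by rw [hψ0, h00]; exact one_ne_zero)).smul h1
  have hev : ∀ᶠ t in 𝓝 (0 : ℂ), AnalyticAt ℂ c t ∧ θ₀ (c t) = 1 ∧ θ₁ (c t) = t ∧
      c t ∈ affineCone Z := by
    filter_upwards [hca.eventually_analyticAt, hψr, hψt.eventually ha0, hψt.eventually hcC]
      with t h1 h2 h3 h4
    refine ⟨h1, ?_, ?_, smul_mem_affineCone h4 _⟩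
    · simp [c, h3]
    · simp only [c, map_smul, smul_eq_mul]
      rw [mul_comm, ← div_eq_mul_inv]
      exact h2
  obtain ⟨r, hr, hball⟩ := Metric.eventually_nhds_iff_ball.1 hev
  refine ⟨θ₀, θ₁, c, r, hr, fun t ht => (hball t ht).1, fun t ht => (hball t ht).2.1,
    fun t ht => (hball t ht).2.2.1, fun t ht => (hball t ht).2.2.2, ?_, ?_⟩
  · have h00z : θ₀ z = 1 := hc0 ▸ h00
    simp [c, hψ0, hc0, h00z]
  · have hne : ∀ᶠ v in 𝓝 z, θ₀ v ≠ 0 :=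
      θ₀.continuous.continuousAt.eventually_ne (by rw [← hc0, h00]; exact one_ne_zero)
    filter_upwards [hU _ (ha0.and hψl), hne] with v hv hv0 hvC
    obtain ⟨t, ⟨hat, hpt⟩, s, rfl⟩ := hv hvC
    have hs : s ≠ 0 := by
      rintro rfl
      simp at hv0
    have : θ₁ (s • c₀ t) / θ₀ (s • c₀ t) = X t := by
      simp only [map_smul, smul_eq_mul, X]
      rw [mul_div_mul_left _ _ hs]
    rw [this]
    simp only [c, hpt, map_smul, smul_eq_mul, smul_smul]
    rw [mul_assoc, mul_inv_cancel₀ hat, mul_one]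

namespace IsGraphChart

variable {Z : Set (ℙ ℂ V)} {z : V} {θ₀ θ₁ : V →L[ℂ] ℂ} {c : ℂ → V} {r : ℝ}

theorem zero_mem (h : IsGraphChart Z z θ₀ θ₁ c r) : (0 : ℂ) ∈ Metric.ball (0 : ℂ) r :=
  Metric.mem_ball_self h.pos

theorem ball_mem_nhds {t : ℂ} (ht : t ∈ Metric.ball (0 : ℂ) r) : Metric.ball (0 : ℂ) r ∈ 𝓝 t :=
  Metric.isOpen_ball.mem_nhds ht

theorem analyticAt_zero (h : IsGraphChart Z z θ₀ θ₁ c r) : AnalyticAt ℂ c 0 :=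
  h.analytic 0 h.zero_mem

theorem tendsto (h : IsGraphChart Z z θ₀ θ₁ c r) : Tendsto c (𝓝 0) (𝓝 z) := by
  simpa [h.curve_zero] using h.analyticAt_zero.continuousAt.tendsto

theorem fst_base (h : IsGraphChart Z z θ₀ θ₁ c r) : θ₀ z = 1 := by
  rw [← h.curve_zero, h.fst 0 h.zero_mem]

theorem snd_base (h : IsGraphChart Z z θ₀ θ₁ c r) : θ₁ z = 0 := by
  rw [← h.curve_zero, h.snd 0 h.zero_mem]

theorem eventually_fst_ne_zero (h : IsGraphChart Z z θ₀ θ₁ c r) : ∀ᶠ v in 𝓝 z, θ₀ v ≠ 0 :=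
  θ₀.continuous.continuousAt.eventually_ne (by rw [h.fst_base]; exact one_ne_zero)

theorem tendsto_param (h : IsGraphChart Z z θ₀ θ₁ c r) :
    Tendsto (fun v => θ₁ v / θ₀ v) (𝓝 z) (𝓝 0) := by
  have h1 : ContinuousAt (fun v => θ₁ v / θ₀ v) z :=
    θ₁.continuous.continuousAt.div θ₀.continuous.continuousAt
      (by rw [h.fst_base]; exact one_ne_zero)
  simpa [h.snd_base] using h1.tendsto

theorem hasDerivAt_comp {E : Type*} [NormedAddCommGroup E] [NormedSpace ℂ E]
    (h : IsGraphChart Z z θ₀ θ₁ c r) (φ : V →L[ℂ] E) {t : ℂ}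
    (ht : t ∈ Metric.ball (0 : ℂ) r) : HasDerivAt (fun t => φ (c t)) (φ (deriv c t)) t :=
  φ.hasFDerivAt.comp_hasDerivAt t (h.analytic t ht).differentiableAt.hasDerivAt

theorem fst_deriv (h : IsGraphChart Z z θ₀ θ₁ c r) {t : ℂ} (ht : t ∈ Metric.ball (0 : ℂ) r) :
    θ₀ (deriv c t) = 0 := by
  refine (h.hasDerivAt_comp θ₀ ht).unique ((hasDerivAt_const t (1 : ℂ)).congr_of_eventuallyEq ?_)
  filter_upwards [ball_mem_nhds ht] with s hs using h.fst s hs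

theorem snd_deriv (h : IsGraphChart Z z θ₀ θ₁ c r) {t : ℂ} (ht : t ∈ Metric.ball (0 : ℂ) r) :
    θ₁ (deriv c t) = 1 := by
  refine (h.hasDerivAt_comp θ₁ ht).unique ((hasDerivAt_id' t).congr_of_eventuallyEq ?_)
  filter_upwards [ball_mem_nhds ht] with s hs using h.snd s hs

theorem span_le_tangentSpace (h : IsGraphChart Z z θ₀ θ₁ c r) {t : ℂ}
    (ht : t ∈ Metric.ball (0 : ℂ) r) {s : ℂ} (hs : s ≠ 0) :
    Submodule.span ℂ {c t, deriv c t} ≤ tangentSpace (affineCone Z) (s • c t) := by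
  have hca := h.analytic t ht
  rw [Submodule.span_le, Set.insert_subset_iff, Set.singleton_subset_iff]
  constructor
  · refine Submodule.subset_span ⟨fun τ => (s + τ) • c t, ⟨?_, ?_, ?_⟩, ?_⟩
    · exact (analyticAt_const.add analyticAt_id).smul analyticAt_const
    · simp
    · exact Eventually.of_forall fun τ => smul_mem_affineCone (h.mem t ht) _
    · have : HasDerivAt (fun τ : ℂ => (s + τ) • c t) ((1 : ℂ) • c t) 0 :=
        ((hasDerivAt_id' (0 : ℂ)).const_add _).smul_const _
      rw [this.deriv, one_smul]
  · have hmem : deriv c t = s⁻¹ • (s • deriv c t) := by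
      rw [smul_smul, inv_mul_cancel₀ hs, one_smul]
    rw [hmem]
    refine Submodule.smul_mem _ _ (Submodule.subset_span
      ⟨fun τ => s • c (t + τ), ⟨?_, ?_, ?_⟩, ?_⟩)
    · have : AnalyticAt ℂ (fun τ => c (t + τ)) 0 :=
        AnalyticAt.comp (g := c) (by simpa using hca) (analyticAt_const.add analyticAt_id)
      exact analyticAt_const.smul this
    · simp
    · have : Tendsto (fun τ : ℂ => t + τ) (𝓝 0) (𝓝 t) := by
        have : ContinuousAt (fun τ : ℂ => t + τ) 0 := by fun_prop
        simpa using this.tendsto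
      filter_upwards [this.eventually (ball_mem_nhds ht)] with τ hτ
      exact smul_mem_affineCone (h.mem _ hτ) _
    · have hcd' : HasDerivAt c (deriv c t) (t + 0) := by
        simpa using hca.differentiableAt.hasDerivAt
      have := (hcd'.scomp (0 : ℂ) ((hasDerivAt_id' (0 : ℂ)).const_add t)).fun_const_smul s
      simpa [Function.comp_def] using this.deriv.symm

/-- The tangent spaces of the affine cone in terms of a chart. -/
theorem eventually_tangentSpace_eq (h : IsGraphChart Z z θ₀ θ₁ c r) :
    ∀ᶠ v in 𝓝 z, v ∈ affineCone Z → tangentSpace (affineCone Z) v =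
      Submodule.span ℂ {c (θ₁ v / θ₀ v), deriv c (θ₁ v / θ₀ v)} := by
  filter_upwards [h.repr.eventually_nhds, h.eventually_fst_ne_zero,
    h.tendsto_param.eventually (ball_mem_nhds h.zero_mem)] with v hv hv0 hvb hvC
  have hve := hv.self_of_nhds hvC
  have hca : AnalyticAt ℂ c (θ₁ v / θ₀ v) := h.analytic _ hvb
  have hcd := hca.differentiableAt.hasDerivAt
  set x := θ₁ v / θ₀ v
  apply le_antisymm
  · refine Submodule.span_le.2 ?_
    rintro w ⟨γ, ⟨hγ, hγ0, hγC⟩, rfl⟩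
    have hγt : Tendsto γ (𝓝 0) (𝓝 v) := by
      have := hγ.continuousAt.tendsto
      rwa [hγ0] at this
    have hγd := hγ.differentiableAt.hasDerivAt
    have d0 : HasDerivAt (fun t => θ₀ (γ t)) (θ₀ (deriv γ 0)) 0 :=
      θ₀.hasFDerivAt.comp_hasDerivAt (0 : ℂ) hγd
    have d1 : HasDerivAt (fun t => θ₁ (γ t)) (θ₁ (deriv γ 0)) 0 :=
      θ₁.hasFDerivAt.comp_hasDerivAt (0 : ℂ) hγd
    have dx := d1.fun_div d0 (by rw [hγ0]; exact hv0)
    have dc : HasDerivAt (fun t => c (θ₁ (γ t) / θ₀ (γ t))) _ 0 :=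
      HasDerivAt.scomp (0 : ℂ) (g₁ := c) (h := fun t => θ₁ (γ t) / θ₀ (γ t))
        (g₁' := deriv c x) (by rw [hγ0]; exact hcd) dx
    have key := d0.fun_smul dc
    have heq : γ =ᶠ[𝓝 0] fun t => θ₀ (γ t) • c (θ₁ (γ t) / θ₀ (γ t)) := by
      filter_upwards [hγt.eventually hv, hγC] with t h1 h2 using h1 h2
    rw [heq.deriv_eq, key.deriv, hγ0]
    refine Submodule.add_mem _ (Submodule.smul_mem _ _ (Submodule.smul_mem _ _ ?_))
      (Submodule.smul_mem _ _ ?_)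
    · exact Submodule.subset_span (by simp)
    · exact Submodule.subset_span (by simp [x])
  · have := h.span_le_tangentSpace hvb hv0
    rwa [← hve] at this

theorem eventually_tangentSpace_curve_eq (h : IsGraphChart Z z θ₀ θ₁ c r) :
    ∀ᶠ t in 𝓝 (0 : ℂ), tangentSpace (affineCone Z) (c t) =
      Submodule.span ℂ {c t, deriv c t} := by
  filter_upwards [h.tendsto.eventually h.eventually_tangentSpace_eq, ball_mem_nhds h.zero_mem]
    with t ht htb
  simpa [h.fst t htb, h.snd t htb] using ht (h.mem t htb)

theorem linearIndependent_deriv (h : IsGraphChart Z z θ₀ θ₁ c r) {t : ℂ}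
    (ht : t ∈ Metric.ball (0 : ℂ) r) : LinearIndependent ℂ ![c t, deriv c t] := by
  rw [LinearIndependent.pair_iff]
  intro a b hab
  have ha : a = 0 := by simpa [h.fst t ht, h.fst_deriv ht] using congr(θ₀ $hab)
  subst ha
  exact ⟨rfl, by simpa [h.snd t ht, h.snd_deriv ht] using congr(θ₁ $hab)⟩

end IsGraphChart

/-! ### Osculating flags of Legendrian curves -/

theorem hasDerivAt_bilin [FiniteDimensional ℂ V] (σ : LinearMap.BilinForm ℂ V) {a b : ℂ → V}
    {a' b' : V} {t : ℂ} (ha : HasDerivAt a a' t) (hb : HasDerivAt b b' t) :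
    HasDerivAt (fun t => σ (a t) (b t)) (σ a' (b t) + σ (a t) b') t := by
  let L : V →L[ℂ] V →L[ℂ] ℂ := LinearMap.toContinuousLinearMap
    ((LinearMap.toContinuousLinearMap : (V →ₗ[ℂ] ℂ) ≃ₗ[ℂ] (V →L[ℂ] ℂ)).toLinearMap ∘ₗ σ)
  exact (L.hasFDerivAt.comp_hasDerivAt t ha).clm_apply hb

/-- Osculating spaces stay inside any hyperplane that contains `C` near the point. -/
theorem osculatingSpace_le_ker [FiniteDimensional ℂ V] {C : Set V} {v : V} (hvC : v ∈ C) (φ : V →L[ℂ] ℂ)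
    (h : ∀ᶠ w in 𝓝 v, w ∈ C → φ w = 0) (k : ℕ) :
    osculatingSpace C v k ≤ LinearMap.ker φ.toLinearMap := by
  have := FiniteDimensional.complete ℂ V
  have harc : ∀ (γ : ℂ → V), IsArcIn C v γ → ∀ n, φ (iteratedDeriv n γ 0) = 0 := by
    rintro γ ⟨hγ, hγ0, hγC⟩ n
    have h0 : (fun t => φ (γ t)) =ᶠ[𝓝 0] fun _ => 0 := by
      have ht := hγ.continuousAt.tendsto
      rw [hγ0] at ht
      filter_upwards [ht.eventually h, hγC] with t h1 h2 using h1 h2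
    have h1 : iteratedDeriv n (fun t => φ (γ t)) 0 = φ (iteratedDeriv n γ 0) := by
      simp only [iteratedDeriv_eq_iteratedFDeriv]
      have := φ.iteratedFDeriv_comp_left (f := γ) (x := (0 : ℂ)) (n := n)
        hγ.contDiffAt (i := n) le_rfl
      exact congr($this fun _ => 1)
    rw [← h1, h0.iteratedDeriv_eq]
    simp
  have h1 : tangentSpace C v ≤ LinearMap.ker φ.toLinearMap := by
    refine Submodule.span_le.2 ?_
    rintro w ⟨γ, hγ, rfl⟩
    simpa using harc γ hγ 1
  induction k using Nat.strong_induction_on with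
  | _ k ih =>
    match k with
    | 0 =>
      refine Submodule.span_le.2 (Set.singleton_subset_iff.2 ?_)
      exact h.self_of_nhds hvC
    | 1 => exact h1
    | k + 2 =>
      refine sup_le (ih (k + 1) (by omega)) (Submodule.span_le.2 ?_)
      rintro w ⟨γ, hγ, rfl⟩
      exact harc γ hγ _

namespace IsGraphChart

variable {Z : Set (ℙ ℂ V)} {z : V} {θ₀ θ₁ : V →L[ℂ] ℂ} {c : ℂ → V} {r : ℝ}

theorem fst_deriv_deriv (h : IsGraphChart Z z θ₀ θ₁ c r) {t : ℂ}
    (hd : AnalyticAt ℂ (deriv c) t)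
    (ht : t ∈ Metric.ball (0 : ℂ) r) : θ₀ (deriv (deriv c) t) = 0 := by
  refine (θ₀.hasFDerivAt.comp_hasDerivAt t hd.differentiableAt.hasDerivAt).unique
    ((hasDerivAt_const t (0 : ℂ)).congr_of_eventuallyEq ?_)
  filter_upwards [ball_mem_nhds ht] with s hs using h.fst_deriv hs

theorem snd_deriv_deriv (h : IsGraphChart Z z θ₀ θ₁ c r) {t : ℂ}
    (hd : AnalyticAt ℂ (deriv c) t)
    (ht : t ∈ Metric.ball (0 : ℂ) r) : θ₁ (deriv (deriv c) t) = 0 := by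
  refine (θ₁.hasFDerivAt.comp_hasDerivAt t hd.differentiableAt.hasDerivAt).unique
    ((hasDerivAt_const t (1 : ℂ)).congr_of_eventuallyEq ?_)
  filter_upwards [ball_mem_nhds ht] with s hs using h.snd_deriv hs

theorem bilin_deriv_eq_zero (h : IsGraphChart Z z θ₀ θ₁ c r) {σ : LinearMap.BilinForm ℂ V}
    (hleg : IsLegendrian σ Z) {t : ℂ} (ht : t ∈ Metric.ball (0 : ℂ) r) :
    σ (c t) (deriv c t) = 0 := by
  have hle := h.span_le_tangentSpace ht one_ne_zero
  rw [one_smul] at hle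
  refine hleg (c t) (h.mem t ht) ?_ _ (hle (Submodule.subset_span (by simp)))
    _ (hle (Submodule.subset_span (by simp)))
  intro h0
  have := h.fst t ht
  simp [h0] at this

variable [FiniteDimensional ℂ V]

theorem analytic_deriv (h : IsGraphChart Z z θ₀ θ₁ c r) :
    AnalyticOnNhd ℂ (deriv c) (Metric.ball 0 r) :=
  have := FiniteDimensional.complete ℂ V
  h.analytic.deriv

theorem analytic_deriv_deriv (h : IsGraphChart Z z θ₀ θ₁ c r) :
    AnalyticOnNhd ℂ (deriv (deriv c)) (Metric.ball 0 r) :=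
  have := FiniteDimensional.complete ℂ V
  h.analytic_deriv.deriv

/-- A curve with `c'' = 0` lies in a line of the projective space, which contains no
nondegenerate point. -/
theorem exists_deriv_deriv_ne_zero (h : IsGraphChart Z z θ₀ θ₁ c r)
    (hV : 2 < Module.finrank ℂ V) (hnd : IsNondegenerateGerm Z z) :
    ∃ t ∈ Metric.ball (0 : ℂ) r, deriv (deriv c) t ≠ 0 := by
  by_contra! hcon
  have hlt : Submodule.span ℂ (Set.range ![c 0, deriv c 0]) < ⊤ := by
    refine lt_top_iff_ne_top.2 fun htop => ?_
    have h1 := finrank_range_le_card (R := ℂ) ![c 0, deriv c 0]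
    rw [Set.finrank, htop, finrank_top, Fintype.card_fin] at h1
    omega
  obtain ⟨φ', hφ0, hφ⟩ := Submodule.exists_le_ker_of_lt_top _ hlt
  let φ : V →L[ℂ] ℂ := LinearMap.toContinuousLinearMap φ'
  have hc0 : φ (c 0) = 0 := hφ (Submodule.subset_span ⟨0, rfl⟩)
  have hc1 : φ (deriv c 0) = 0 := hφ (Submodule.subset_span ⟨1, rfl⟩)
  have hball : IsPreconnected (Metric.ball (0 : ℂ) r) := (convex_ball _ _).isPreconnected
  have hd1 : ∀ t ∈ Metric.ball (0 : ℂ) r, φ (deriv c t) = 0 := by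
    intro t ht
    have hd : ∀ t ∈ Metric.ball (0 : ℂ) r,
        HasDerivAt (fun t => φ (deriv c t)) (φ (deriv (deriv c) t)) t := fun t ht =>
      φ.hasFDerivAt.comp_hasDerivAt t (h.analytic_deriv t ht).differentiableAt.hasDerivAt
    have := Metric.isOpen_ball.is_const_of_deriv_eq_zero hball
      (fun t ht => (hd t ht).differentiableAt.differentiableWithinAt)
      (fun t ht => by simp [(hd t ht).deriv, hcon t ht]) ht h.zero_mem
    simpa [hc1] using this
  have hd0 : ∀ t ∈ Metric.ball (0 : ℂ) r, φ (c t) = 0 := by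
    intro t ht
    have := Metric.isOpen_ball.is_const_of_deriv_eq_zero hball
      (fun t ht => (h.hasDerivAt_comp φ ht).differentiableAt.differentiableWithinAt)
      (fun t ht => by simp [(h.hasDerivAt_comp φ ht).deriv, hd1 t ht]) ht h.zero_mem
    simpa [hc0] using this
  have hev : ∀ᶠ v in 𝓝 z, v ∈ affineCone Z → φ v = 0 := by
    filter_upwards [h.repr, h.tendsto_param.eventually (ball_mem_nhds h.zero_mem)]
      with v hv hvb hvC
    rw [hv hvC, map_smul, hd0 _ hvb, smul_zero]
  obtain ⟨v, ⟨hvC, hv0, k, -, hk⟩, hvev⟩ := (hnd.and_eventually hev.eventually_nhds).exists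
  have := osculatingSpace_le_ker hvC φ hvev k
  rw [hk, top_le_iff, LinearMap.ker_eq_top] at this
  exact hφ0 this

theorem bilin_deriv_deriv_eq_zero (h : IsGraphChart Z z θ₀ θ₁ c r)
    {σ : LinearMap.BilinForm ℂ V} (hσ : σ.IsAlt) (hleg : IsLegendrian σ Z) {t : ℂ}
    (ht : t ∈ Metric.ball (0 : ℂ) r) : σ (c t) (deriv (deriv c) t) = 0 := by
  have := (hasDerivAt_bilin σ (h.analytic t ht).differentiableAt.hasDerivAt
    (h.analytic_deriv t ht).differentiableAt.hasDerivAt).unique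
    ((hasDerivAt_const t (0 : ℂ)).congr_of_eventuallyEq (by
      filter_upwards [ball_mem_nhds ht] with s hs using h.bilin_deriv_eq_zero hleg hs))
  rwa [hσ.self_eq_zero, zero_add] at this

theorem bilin_deriv_third (h : IsGraphChart Z z θ₀ θ₁ c r)
    {σ : LinearMap.BilinForm ℂ V} (hσ : σ.IsAlt) (hleg : IsLegendrian σ Z) {t : ℂ}
    (ht : t ∈ Metric.ball (0 : ℂ) r) :
    σ (deriv c t) (deriv (deriv c) t) + σ (c t) (deriv (deriv (deriv c)) t) = 0 :=
  (hasDerivAt_bilin σ (h.analytic t ht).differentiableAt.hasDerivAt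
    (h.analytic_deriv_deriv t ht).differentiableAt.hasDerivAt).unique
    ((hasDerivAt_const t (0 : ℂ)).congr_of_eventuallyEq (by
      filter_upwards [ball_mem_nhds ht] with s hs using h.bilin_deriv_deriv_eq_zero hσ hleg hs))

/-- The tangent planes of a Legendrian curve are Lagrangian: they are their own orthogonal
complements. -/
theorem mem_span_of_bilin_eq_zero (h : IsGraphChart Z z θ₀ θ₁ c r)
    (hV : Module.finrank ℂ V = 4) {σ : LinearMap.BilinForm ℂ V} (hσ : σ.IsAlt)
    (hσn : σ.Nondegenerate) (hleg : IsLegendrian σ Z) {t : ℂ}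
    (ht : t ∈ Metric.ball (0 : ℂ) r) {v : V} (h0 : σ (c t) v = 0) (h1 : σ (deriv c t) v = 0) :
    v ∈ Submodule.span ℂ {c t, deriv c t} := by
  have hrange : Set.range ![c t, deriv c t] = {c t, deriv c t} := by
    simp [Set.pair_comm (deriv c t)]
  set W := Submodule.span ℂ {c t, deriv c t} with hW
  have hWr : Module.finrank ℂ W = 2 := by
    have := finrank_span_eq_card (h.linearIndependent_deriv ht)
    rwa [hrange, Fintype.card_fin] at this
  have hort : ∀ {w : V}, σ (c t) w = 0 → σ (deriv c t) w = 0 → w ∈ σ.orthogonal W := by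
    intro w hw0 hw1
    rw [LinearMap.BilinForm.mem_orthogonal_iff]
    intro n hn
    obtain ⟨a, b, rfl⟩ := Submodule.mem_span_pair.1 hn
    simp [hw0, hw1]
  have hle : W ≤ σ.orthogonal W := by
    refine Submodule.span_le.2 ?_
    have e := h.bilin_deriv_eq_zero hleg ht
    rw [Set.insert_subset_iff, Set.singleton_subset_iff]
    refine ⟨hort (hσ.self_eq_zero _) ?_, hort e (hσ.self_eq_zero _)⟩
    rw [← hσ.neg_eq, e, neg_zero]
  have hfr := LinearMap.BilinForm.finrank_orthogonal hσn W
  rw [hV, hWr] at hfr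
  rw [Submodule.eq_of_le_of_finrank_eq hle (by rw [hWr, hfr])]
  exact hort h0 h1

theorem bilin_deriv_deriv_deriv_ne_zero (h : IsGraphChart Z z θ₀ θ₁ c r)
    (hV : Module.finrank ℂ V = 4) {σ : LinearMap.BilinForm ℂ V} (hσ : σ.IsAlt)
    (hσn : σ.Nondegenerate) (hleg : IsLegendrian σ Z) {t : ℂ}
    (ht : t ∈ Metric.ball (0 : ℂ) r) (h2 : deriv (deriv c) t ≠ 0) :
    σ (deriv c t) (deriv (deriv c) t) ≠ 0 := by
  -- Otherwise `c''` lies in the tangent plane, but `θ₀` and `θ₁`, which are coordinates on that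
  -- plane, vanish on `c''`.
  intro h1
  obtain ⟨a, b, hab⟩ := Submodule.mem_span_pair.1 (h.mem_span_of_bilin_eq_zero hV hσ hσn hleg ht
    (h.bilin_deriv_deriv_eq_zero hσ hleg ht) h1)
  have ha : a = 0 := by
    simpa [h.fst t ht, h.fst_deriv ht, h.fst_deriv_deriv (h.analytic_deriv t ht) ht]
      using congr(θ₀ $hab)
  have hb : b = 0 := by
    simpa [h.snd t ht, h.snd_deriv ht, h.snd_deriv_deriv (h.analytic_deriv t ht) ht, ha]
      using congr(θ₁ $hab)
  exact h2 (by rw [← hab, ha, hb, zero_smul, zero_smul, add_zero])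

/-- Where `c'' ≠ 0`, the osculating flag of a Legendrian curve in dimension `4` is complete. -/
theorem linearIndependent_osculating (h : IsGraphChart Z z θ₀ θ₁ c r)
    (hV : Module.finrank ℂ V = 4) {σ : LinearMap.BilinForm ℂ V} (hσ : σ.IsAlt)
    (hσn : σ.Nondegenerate) (hleg : IsLegendrian σ Z) {t : ℂ}
    (ht : t ∈ Metric.ball (0 : ℂ) r) (h2 : deriv (deriv c) t ≠ 0) :
    LinearIndependent ℂ ![c t, deriv c t, deriv (deriv c) t, deriv (deriv (deriv c)) t] := by
  have hB := h.bilin_deriv_deriv_deriv_ne_zero hV hσ hσn hleg ht h2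
  have hA := h.bilin_deriv_third hσ hleg ht
  have hA' : σ (c t) (deriv (deriv (deriv c)) t) ≠ 0 := by
    intro h0
    rw [h0, add_zero] at hA
    exact hB hA
  rw [Fintype.linearIndependent_iff]
  intro g hg
  simp only [Fin.sum_univ_four, Matrix.cons_val] at hg
  have g3 : g 3 = 0 := by
    simpa [hσ.self_eq_zero, h.bilin_deriv_eq_zero hleg ht, h.bilin_deriv_deriv_eq_zero hσ hleg ht,
      hA'] using congr(σ (c t) $hg)
  have hcc : σ (deriv c t) (c t) = 0 := by
    rw [← hσ.neg_eq, h.bilin_deriv_eq_zero hleg ht, neg_zero]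
  have g2 : g 2 = 0 := by
    simpa [hσ.self_eq_zero, hcc, hB, g3] using congr(σ (deriv c t) $hg)
  simp only [g3, g2, zero_smul, add_zero] at hg
  have h01 := LinearIndependent.pair_iff.1 (h.linearIndependent_deriv ht) _ _ hg
  intro i
  fin_cases i
  exacts [h01.1, h01.2, g2, g3]

/-- A Legendrian curve with `c'' ≠ 0` at some point spans `V`: a linear map that vanishes along it
near that point is zero. -/
theorem linearMap_eq_zero (h : IsGraphChart Z z θ₀ θ₁ c r)
    (hV : Module.finrank ℂ V = 4) {σ : LinearMap.BilinForm ℂ V} (hσ : σ.IsAlt)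
    (hσn : σ.Nondegenerate) (hleg : IsLegendrian σ Z) {t : ℂ}
    (ht : t ∈ Metric.ball (0 : ℂ) r) (h2 : deriv (deriv c) t ≠ 0)
    {E : Type*} [NormedAddCommGroup E] [NormedSpace ℂ E] (A : V →L[ℂ] E)
    (hA : ∀ᶠ s in 𝓝 t, A (c s) = 0) : A = 0 := by
  have step : ∀ b : ℂ → V, (∀ s ∈ Metric.ball (0 : ℂ) r, AnalyticAt ℂ b s) →
      (∀ᶠ s in 𝓝 t, A (b s) = 0) → ∀ᶠ s in 𝓝 t, A (deriv b s) = 0 := by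
    intro b hb h0
    filter_upwards [h0.eventually_nhds, ball_mem_nhds ht] with s hs hsb
    exact (A.hasFDerivAt.comp_hasDerivAt s (hb s hsb).differentiableAt.hasDerivAt).unique
      ((hasDerivAt_const s (0 : E)).congr_of_eventuallyEq hs)
  have h1 := step _ h.analytic hA
  have h2' := step _ h.analytic_deriv h1
  have h3 := step _ h.analytic_deriv_deriv h2'
  have hli := h.linearIndependent_osculating hV hσ hσn hleg ht h2
  have : A.toLinearMap = 0 := by
    refine (basisOfLinearIndependentOfCardEqFinrank hli (by simp [hV])).ext fun i => ?_
    fin_cases i <;>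
      simp [hA.self_of_nhds, h1.self_of_nhds, h2'.self_of_nhds, h3.self_of_nhds]
  ext v
  exact LinearMap.congr_fun this v

end IsGraphChart

/-! ### The vector fields induced on the curve -/

/-- The vector field `f(t) ∂ₜ` that a linear map `u` tangent to the curve induces in the chart:
the number `f(t)` with `u (c t) ≡ f(t) c'(t)` modulo `c t`. -/
def inducedField (θ₀ θ₁ : V →L[ℂ] ℂ) (c : ℂ → V) (u : Module.End ℂ V) (t : ℂ) : ℂ :=
  θ₁ (u (c t)) - t * θ₀ (u (c t))

namespace IsGraphChart

variable {Z : Set (ℙ ℂ V)} {z : V} {θ₀ θ₁ : V →L[ℂ] ℂ} {c : ℂ → V} {r : ℝ}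
  [FiniteDimensional ℂ V]

theorem analytic_apply (h : IsGraphChart Z z θ₀ θ₁ c r) {E : Type*} [NormedAddCommGroup E]
    [NormedSpace ℂ E] (u : V →ₗ[ℂ] E) :
    AnalyticOnNhd ℂ (fun t => u (c t)) (Metric.ball 0 r) := fun t ht =>
  ((LinearMap.toContinuousLinearMap u).analyticAt _).comp (h.analytic t ht)

theorem analytic_fst_apply (h : IsGraphChart Z z θ₀ θ₁ c r) (u : Module.End ℂ V) :
    AnalyticOnNhd ℂ (fun t => θ₀ (u (c t))) (Metric.ball 0 r) :=
  h.analytic_apply (θ₀.toLinearMap ∘ₗ u)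

theorem analytic_inducedField (h : IsGraphChart Z z θ₀ θ₁ c r) (u : Module.End ℂ V) :
    AnalyticOnNhd ℂ (inducedField θ₀ θ₁ c u) (Metric.ball 0 r) := fun t ht =>
  (h.analytic_apply (θ₁.toLinearMap ∘ₗ u) t ht).sub
    (analyticAt_id.mul (h.analytic_fst_apply u t ht))

theorem isPreconnected_ball (r : ℝ) : IsPreconnected (Metric.ball (0 : ℂ) r) :=
  (convex_ball _ _).isPreconnected

theorem apply_eq (h : IsGraphChart Z z θ₀ θ₁ c r) {σ : LinearMap.BilinForm ℂ V}
    {u : Module.End ℂ V} (hu : u ∈ autGerm σ Z z) {t : ℂ} (ht : t ∈ Metric.ball (0 : ℂ) r) :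
    u (c t) = θ₀ (u (c t)) • c t + inducedField θ₀ θ₁ c u t • deriv c t := by
  have h1 : AnalyticOnNhd ℂ (fun t => u (c t)) (Metric.ball 0 r) := h.analytic_apply u
  have h2 : AnalyticOnNhd ℂ
      (fun t => θ₀ (u (c t)) • c t + inducedField θ₀ θ₁ c u t • deriv c t)
      (Metric.ball 0 r) := fun t ht =>
    ((h.analytic_fst_apply u t ht).smul (h.analytic t ht)).add
      ((h.analytic_inducedField u t ht).smul (h.analytic_deriv t ht))
  refine h1.eqOn_of_preconnected_of_eventuallyEq h2 (isPreconnected_ball r) h.zero_mem ?_ ht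
  filter_upwards [h.tendsto.eventually hu.2, h.eventually_tangentSpace_curve_eq,
    ball_mem_nhds h.zero_mem] with s hs hT hsb
  have := hs (h.mem s hsb)
  rw [hT] at this
  obtain ⟨a, b, hab⟩ := Submodule.mem_span_pair.1 this
  have ha : a = θ₀ (u (c s)) := by
    simpa [h.fst s hsb, h.fst_deriv hsb] using congr(θ₀ $hab)
  have hb : b = inducedField θ₀ θ₁ c u s := by
    have := congr(θ₁ $hab)
    simp only [map_add, map_smul, smul_eq_mul, h.snd s hsb, h.snd_deriv hsb] at this
    rw [inducedField, ← ha, ← this]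
    ring
  rw [← ha, ← hb, hab]

/-- A linear map that fixes all points of a curve spanning `V` is a scalar. -/
theorem eq_smul_one_of_inducedField_eq_zero (h : IsGraphChart Z z θ₀ θ₁ c r)
    (hV : Module.finrank ℂ V = 4) {σ : LinearMap.BilinForm ℂ V} (hσ : σ.IsAlt)
    (hσn : σ.Nondegenerate) (hleg : IsLegendrian σ Z) {p : ℂ}
    (hp : p ∈ Metric.ball (0 : ℂ) r) (h2 : deriv (deriv c) p ≠ 0)
    {u : Module.End ℂ V} (hu : u ∈ autGerm σ Z z)
    (hf : ∀ᶠ t in 𝓝 p, inducedField θ₀ θ₁ c u t = 0) : ∃ l : ℂ, u = l • 1 := by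
  have : Nontrivial V := Module.nontrivial_of_finrank_pos (R := ℂ) (by omega)
  obtain ⟨l, hl⟩ := Module.End.exists_eigenvalue (Module.Dual.transpose (R := ℂ) u)
  obtain ⟨ε, hε⟩ := hl.exists_hasEigenvector
  have hεu : ∀ v, ε (u v) = l * ε v := fun v => LinearMap.congr_fun hε.apply_eq_smul v
  have heq : ∀ᶠ t in 𝓝 p, u (c t) = θ₀ (u (c t)) • c t := by
    filter_upwards [hf, ball_mem_nhds hp] with t h1 h3
    conv_lhs => rw [h.apply_eq hu h3, h1, zero_smul, add_zero]
  -- The weight `θ₀ (u (c t))` is an eigenvalue of `u` on the line of `c t`; it agrees with `l`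
  -- wherever `ε (c t) ≠ 0`.
  have hne : ¬ ∀ᶠ t in 𝓝 p, ε (c t) = 0 := fun h0 => hε.2 <| by
    have := h.linearMap_eq_zero hV hσ hσn hleg hp h2 (LinearMap.toContinuousLinearMap ε) h0
    simpa using this
  have hne' := ((h.analytic_apply ε p hp).eventually_eq_zero_or_eventually_ne_zero).resolve_left
    hne
  have hg : ∀ᶠ t in 𝓝 p, θ₀ (u (c t)) - l = 0 := by
    refine ((h.analytic_fst_apply u p hp).sub
      analyticAt_const).frequently_zero_iff_eventually_zero.1 (Eventually.frequently ?_)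
    filter_upwards [hne', heq.filter_mono nhdsWithin_le_nhds] with t h1 h3
    have := congr(ε $h3)
    rw [hεu, map_smul, smul_eq_mul] at this
    exact sub_eq_zero.2 (mul_right_cancel₀ h1 this.symm)
  have := h.linearMap_eq_zero hV hσ hσn hleg hp h2
    (LinearMap.toContinuousLinearMap (u - l • (1 : Module.End ℂ V))) (by
      filter_upwards [hg, heq] with t h1 h3
      have h4 : u (c t) = l • c t := by
        conv_lhs => rw [h3, sub_eq_zero.1 h1]
      simp [h4])
  exact ⟨l, sub_eq_zero.1 (LinearMap.toContinuousLinearMap.map_eq_zero_iff.1 this)⟩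

/-- An algebra of dimension at least `3` induces two independent vector fields on the curve, and
so, at a general point, a vector field with a simple zero. -/
theorem exists_simple_zero (h : IsGraphChart Z z θ₀ θ₁ c r)
    (hV : Module.finrank ℂ V = 4) {σ : LinearMap.BilinForm ℂ V} (hσ : σ.IsAlt)
    (hσn : σ.Nondegenerate) (hleg : IsLegendrian σ Z) (hnd : IsNondegenerateGerm Z z)
    (hdim : 3 ≤ Module.finrank ℂ (autGerm σ Z z)) :
    ∃ p ∈ Metric.ball (0 : ℂ) r, deriv (deriv c) p ≠ 0 ∧ ∃ u ∈ autGerm σ Z z,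
      inducedField θ₀ θ₁ c u p = 0 ∧ deriv (inducedField θ₀ θ₁ c u) p = 1 := by
  have hconn := isPreconnected_ball r
  obtain ⟨q, hq, hq2⟩ := h.exists_deriv_deriv_ne_zero (by omega) hnd
  have hnot : ∀ S : Finset (Module.End ℂ V), S.card < 3 →
      ∃ u ∈ autGerm σ Z z, u ∉ Submodule.span ℂ (S : Set (Module.End ℂ V)) := by
    intro S hS
    by_contra! hcon
    have h1 : autGerm σ Z z ≤ Submodule.span ℂ (S : Set (Module.End ℂ V)) := hcon
    have h2 := Submodule.finrank_mono h1
    have h3 := finrank_span_finset_le_card (R := ℂ) S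
    rw [Set.finrank] at h3
    omega
  classical
  obtain ⟨u₁, hu₁, hu₁n⟩ := hnot {1} (by simp)
  obtain ⟨u₂, hu₂, hu₂n⟩ := hnot {1, u₁} (lt_of_le_of_lt Finset.card_le_two (by norm_num))
  set f₁ := inducedField θ₀ θ₁ c u₁ with hf₁
  set f₂ := inducedField θ₀ θ₁ c u₂ with hf₂
  have a₁ : AnalyticOnNhd ℂ f₁ (Metric.ball 0 r) := h.analytic_inducedField u₁
  have a₂ : AnalyticOnNhd ℂ f₂ (Metric.ball 0 r) := h.analytic_inducedField u₂
  have hlin : ∀ (a b t : ℂ), inducedField θ₀ θ₁ c (a • u₁ + b • u₂) t = a * f₁ t + b * f₂ t := by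
    intro a b t
    simp only [hf₁, hf₂, inducedField, LinearMap.add_apply, LinearMap.smul_apply, map_add,
      map_smul, smul_eq_mul]
    ring
  have hWa : AnalyticOnNhd ℂ (fun t => f₁ t * deriv f₂ t - deriv f₁ t * f₂ t)
      (Metric.ball 0 r) := fun t ht =>
    ((a₁ t ht).mul (a₂ t ht).deriv).sub ((a₁ t ht).deriv.mul (a₂ t ht))
  have hW : ¬ ∀ᶠ t in 𝓝 (0 : ℂ), f₁ t * deriv f₂ t - deriv f₁ t * f₂ t = 0 := by
    intro h0
    have hW0 := hWa.eqOn_zero_of_preconnected_of_eventuallyEq_zero hconn h.zero_mem h0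
    have hex : ∃ s ∈ Metric.ball (0 : ℂ) r, f₁ s ≠ 0 := by
      by_contra! hcon
      obtain ⟨l, hl⟩ := h.eq_smul_one_of_inducedField_eq_zero hV hσ hσn hleg hq hq2 hu₁
        (by filter_upwards [ball_mem_nhds hq] with s hs using hcon s hs)
      exact hu₁n (by simpa using Submodule.mem_span_singleton.2 ⟨l, hl.symm⟩)
    obtain ⟨s, hs, hfs⟩ := hex
    have h3 := eventually_eq_mul_of_wronskian_eq_zero (a₁ s hs) (a₂ s hs) hfs
      (by filter_upwards [ball_mem_nhds hs] with t ht using hW0 ht)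
    set k := f₂ s / f₁ s
    have h4 : Set.EqOn f₂ (fun t => k * f₁ t) (Metric.ball 0 r) :=
      a₂.eqOn_of_preconnected_of_eventuallyEq (fun t ht => analyticAt_const.mul (a₁ t ht))
        hconn hs h3
    obtain ⟨l, hl⟩ := h.eq_smul_one_of_inducedField_eq_zero hV hσ hσn hleg hq hq2
      (u := (-k) • u₁ + (1 : ℂ) • u₂)
      (add_mem (Submodule.smul_mem _ _ hu₁) (Submodule.smul_mem _ _ hu₂)) (by
        filter_upwards [ball_mem_nhds hq] with t ht
        rw [hlin, h4 ht]
        ring)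
    refine hu₂n ?_
    rw [Finset.coe_pair]
    refine Submodule.mem_span_pair.2 ⟨l, k, ?_⟩
    rw [← hl]
    simp
  have hc2 : ¬ ∀ᶠ t in 𝓝 (0 : ℂ), deriv (deriv c) t = 0 := fun h0 => hq2
    (h.analytic_deriv_deriv.eqOn_zero_of_preconnected_of_eventuallyEq_zero hconn h.zero_mem h0 hq)
  have e1 := ((hWa 0 h.zero_mem).eventually_eq_zero_or_eventually_ne_zero).resolve_left hW
  have e2 := ((h.analytic_deriv_deriv 0
    h.zero_mem).eventually_eq_zero_or_eventually_ne_zero).resolve_left hc2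
  have e3 : ∀ᶠ t in 𝓝[≠] (0 : ℂ), t ∈ Metric.ball (0 : ℂ) r :=
    nhdsWithin_le_nhds (ball_mem_nhds h.zero_mem)
  obtain ⟨p, ⟨hp1, hp2⟩, hp⟩ := ((e1.and e2).and e3).exists
  set W := f₁ p * deriv f₂ p - deriv f₁ p * f₂ p with hWdef
  refine ⟨p, hp, hp2, (-(W⁻¹ * f₂ p)) • u₁ + (W⁻¹ * f₁ p) • u₂,
    add_mem (Submodule.smul_mem _ _ hu₁) (Submodule.smul_mem _ _ hu₂), ?_, ?_⟩
  · rw [hlin]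
    ring
  · rw [funext (hlin _ _)]
    rw [(((a₁ p hp).differentiableAt.hasDerivAt.const_mul _).fun_add
      ((a₂ p hp).differentiableAt.hasDerivAt.const_mul _)).deriv]
    have : W⁻¹ * W = 1 := inv_mul_cancel₀ hp1
    rw [← this, hWdef]
    ring

end IsGraphChart

/-! ### Eigenbases at a simple zero -/

/-- A linear map that is upper triangular on a basis, with diagonal entries `l`, `l + 1`, `l + 2`,
`l + 3`, has an eigenbasis with these eigenvalues. -/
theorem exists_basis_of_triangular {V : Type*} [AddCommGroup V] [Module ℂ V]
    (hV : Module.finrank ℂ V = 4) {u : Module.End ℂ V} {w : Fin 4 → V}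
    (hw : LinearIndependent ℂ w) {l a b d p q s : ℂ} (h0 : u (w 0) = l • w 0)
    (h1 : u (w 1) = a • w 0 + (l + 1) • w 1)
    (h2 : u (w 2) = b • w 0 + d • w 1 + (l + 2) • w 2)
    (h3 : u (w 3) = p • w 0 + q • w 1 + s • w 2 + (l + 3) • w 3) :
    ∃ e : Module.Basis (Fin 4) ℂ V, ∀ i : Fin 4, u (e i) = (l + (i : ℕ)) • e i := by
  have hne : ∀ g : Fin 4 → ℂ, (∃ i, g i ≠ 0) → ∑ i, g i • w i ≠ 0 := by
    rintro g ⟨i, hi⟩ hsum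
    exact hi (Fintype.linearIndependent_iff.1 hw g hsum i)
  -- Back substitution in the triangular systems `(u - (l + i)) (e i) = 0`; the differences of
  -- eigenvalues `1`, `2`, `3` are the denominators.
  let y := (q + d * s) / 2
  let e : Fin 4 → V := ![w 0, w 1 + a • w 0, w 2 + d • w 1 + ((b + a * d) / 2) • w 0,
    w 3 + s • w 2 + y • w 1 + ((p + b * s + a * y) / 3) • w 0]
  have he : ∀ i : Fin 4, u (e i) = (l + (i : ℕ)) • e i := by
    intro i
    fin_cases i
    · simp [e, h0]
    · simp only [e, Fin.mk_one, Matrix.cons_val, map_add, map_smul, h0, h1]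
      push_cast
      match_scalars <;> ring
    · simp only [e, Fin.reduceFinMk, Matrix.cons_val, map_add, map_smul, h0, h1, h2]
      push_cast
      match_scalars <;> ring
    · simp only [e, y, Fin.reduceFinMk, Matrix.cons_val, map_add, map_smul, h0, h1, h2, h3]
      push_cast
      match_scalars <;> ring
  have he0 : ∀ i, e i ≠ 0 := by
    intro i
    fin_cases i
    · simpa [Fin.sum_univ_four, e] using hne ![1, 0, 0, 0] ⟨0, by simp⟩
    · simpa [Fin.sum_univ_four, e, add_comm] using hne ![a, 1, 0, 0] ⟨1, by simp⟩
    · have := hne ![(b + a * d) / 2, d, 1, 0] ⟨2, by simp⟩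
      simp only [Fin.sum_univ_four, Matrix.cons_val] at this
      refine fun h => this (Eq.trans ?_ h)
      simp only [e, Fin.reduceFinMk, Matrix.cons_val]
      module
    · have := hne ![(p + b * s + a * y) / 3, y, s, 1] ⟨3, by simp⟩
      simp only [Fin.sum_univ_four, Matrix.cons_val] at this
      refine fun h => this (Eq.trans ?_ h)
      simp only [e, Fin.reduceFinMk, Matrix.cons_val]
      module
  have hli : LinearIndependent ℂ e := by
    refine Module.End.eigenvectors_linearIndependent' u (fun i : Fin 4 => l + ((i : ℕ) : ℂ)) ?_ e
      fun i => ⟨Module.End.mem_eigenspace_iff.2 (he i), he0 i⟩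
    intro i j hij
    exact Fin.ext (by exact_mod_cast add_left_cancel hij)
  refine ⟨basisOfLinearIndependentOfCardEqFinrank hli (by simp [hV]), fun i => ?_⟩
  simpa using he i

namespace IsGraphChart

variable {Z : Set (ℙ ℂ V)} {z : V} {θ₀ θ₁ : V →L[ℂ] ℂ} {c : ℂ → V} {r : ℝ}
  [FiniteDimensional ℂ V]

/-- If the vector field induced by `u` has a simple zero at `p`, then `u` is upper triangular on the
osculating flag at `p`: each derivative of the curve raises the weight by `f'(p) = 1`. -/
theorem exists_eigenbasis (h : IsGraphChart Z z θ₀ θ₁ c r)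
    (hV : Module.finrank ℂ V = 4) {σ : LinearMap.BilinForm ℂ V} (hσ : σ.IsAlt)
    (hσn : σ.Nondegenerate) (hleg : IsLegendrian σ Z) {p : ℂ}
    (hp : p ∈ Metric.ball (0 : ℂ) r) (h2 : deriv (deriv c) p ≠ 0) {u : Module.End ℂ V}
    (hu : u ∈ autGerm σ Z z) (hf : inducedField θ₀ θ₁ c u p = 0)
    (hf' : deriv (inducedField θ₀ θ₁ c u) p = 1) :
    ∃ e : Module.Basis (Fin 4) ℂ V, ∀ i : Fin 4, u (e i) = (θ₀ (u (c p)) + (i : ℕ)) • e i := by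
  have := FiniteDimensional.complete ℂ V
  let U : V →L[ℂ] V := LinearMap.toContinuousLinearMap u
  set f := inducedField θ₀ θ₁ c u
  set g : ℂ → ℂ := fun t => θ₀ (u (c t))
  have hfa : AnalyticOnNhd ℂ f (Metric.ball 0 r) := h.analytic_inducedField u
  have hga : AnalyticOnNhd ℂ g (Metric.ball 0 r) := h.analytic_fst_apply u
  have dg := fun t ht => (hga t ht).differentiableAt.hasDerivAt
  have dg1 := fun t ht => (hga.deriv t ht).differentiableAt.hasDerivAt
  have dg2 := fun t ht => (hga.deriv.deriv t ht).differentiableAt.hasDerivAt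
  have df := fun t ht => (hfa t ht).differentiableAt.hasDerivAt
  have df1 := fun t ht => (hfa.deriv t ht).differentiableAt.hasDerivAt
  have df2 := fun t ht => (hfa.deriv.deriv t ht).differentiableAt.hasDerivAt
  have dc := fun t ht => (h.analytic t ht).differentiableAt.hasDerivAt
  have dc1 := fun t ht => (h.analytic_deriv t ht).differentiableAt.hasDerivAt
  have dc2 := fun t ht => (h.analytic_deriv_deriv t ht).differentiableAt.hasDerivAt
  have dc3 := fun t ht => (h.analytic_deriv_deriv.deriv t ht).differentiableAt.hasDerivAt
  -- The derivatives of `u (c t) = g c + f c'` up to order three.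
  have D0 : ∀ t ∈ Metric.ball (0 : ℂ) r, u (c t) = g t • c t + f t • deriv c t :=
    fun t ht => h.apply_eq hu ht
  have D1 : ∀ t ∈ Metric.ball (0 : ℂ) r, u (deriv c t) =
      deriv g t • c t + (g t + deriv f t) • deriv c t + f t • deriv (deriv c) t := by
    intro t ht
    have e1 := U.hasFDerivAt.comp_hasDerivAt t (dc t ht)
    have e2 := ((dg t ht).fun_smul (dc t ht)).fun_add ((df t ht).fun_smul (dc1 t ht))
    have e3 := e1.unique (e2.congr_of_eventuallyEq (by
      filter_upwards [ball_mem_nhds ht] with s hs using D0 s hs))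
    refine Eq.trans e3 ?_
    module
  have D2 : ∀ t ∈ Metric.ball (0 : ℂ) r, u (deriv (deriv c) t) =
      deriv (deriv g) t • c t + (2 * deriv g t + deriv (deriv f) t) • deriv c t +
        (g t + 2 * deriv f t) • deriv (deriv c) t + f t • deriv (deriv (deriv c)) t := by
    intro t ht
    have e1 := U.hasFDerivAt.comp_hasDerivAt t (dc1 t ht)
    have e2 := (((dg1 t ht).fun_smul (dc t ht)).fun_add
      (((dg t ht).fun_add (df1 t ht)).fun_smul (dc1 t ht))).fun_add
      ((df t ht).fun_smul (dc2 t ht))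
    have e3 := e1.unique (e2.congr_of_eventuallyEq (by
      filter_upwards [ball_mem_nhds ht] with s hs using D1 s hs))
    refine Eq.trans e3 ?_
    module
  have D3 : ∃ a b d : ℂ, u (deriv (deriv (deriv c)) p) =
      a • c p + b • deriv c p + d • deriv (deriv c) p +
        (g p + 3) • deriv (deriv (deriv c)) p := by
    have e1 := U.hasFDerivAt.comp_hasDerivAt p (dc2 p hp)
    have e2 := ((((dg2 p hp).fun_smul (dc p hp)).fun_add
      ((((dg1 p hp).const_mul 2).fun_add (df2 p hp)).fun_smul (dc1 p hp))).fun_add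
      (((dg p hp).fun_add ((df1 p hp).const_mul 2)).fun_smul (dc2 p hp))).fun_add
      ((df p hp).fun_smul (dc3 p hp))
    have e3 := e1.unique (e2.congr_of_eventuallyEq (by
      filter_upwards [ball_mem_nhds hp] with s hs using D2 s hs))
    rw [hf, hf'] at e3
    refine ⟨deriv (deriv (deriv g)) p, 3 * deriv (deriv g) p + deriv (deriv (deriv f)) p,
      3 * deriv g p + 3 * deriv (deriv f) p, Eq.trans e3 ?_⟩
    module
  obtain ⟨a, b, d, D3⟩ := D3
  have D0p := D0 p hp
  have D1p := D1 p hp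
  have D2p := D2 p hp
  rw [hf, zero_smul, add_zero] at D0p D1p D2p
  rw [hf'] at D1p D2p
  rw [mul_one] at D2p
  exact exists_basis_of_triangular hV
    (h.linearIndependent_osculating hV hσ hσn hleg hp h2) D0p D1p D2p D3

end IsGraphChart

/-! ### Recognition of the twisted cubic -/

namespace IsGraphChart

variable {Z : Set (ℙ ℂ V)} {z : V} {θ₀ θ₁ : V →L[ℂ] ℂ} {c : ℂ → V} {r : ℝ}
  [FiniteDimensional ℂ V]

/-- In an eigenbasis the coordinates `hᵢ` of the curve satisfy `f hᵢ' = (lᵢ - g) hᵢ`. -/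
theorem mul_coord_deriv_eq (h : IsGraphChart Z z θ₀ θ₁ c r) {σ : LinearMap.BilinForm ℂ V}
    {u : Module.End ℂ V} (hu : u ∈ autGerm σ Z z) {e : Module.Basis (Fin 4) ℂ V} {l : Fin 4 → ℂ}
    (he : ∀ i, u (e i) = l i • e i) (i : Fin 4) {t : ℂ} (ht : t ∈ Metric.ball (0 : ℂ) r) :
    inducedField θ₀ θ₁ c u t * e.coord i (deriv c t) =
      (l i - θ₀ (u (c t))) * e.coord i (c t) := by
  have h1 : e.coord i ∘ₗ u = l i • e.coord i := by
    refine e.ext fun j => ?_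
    by_cases hij : j = i
    · subst hij
      simp [he]
    · simp [he, hij]
  have h2 := LinearMap.congr_fun h1 (c t)
  rw [LinearMap.comp_apply, h.apply_eq hu ht, map_add, map_smul, map_smul] at h2
  simp only [LinearMap.smul_apply, smul_eq_mul] at h2
  linear_combination h2

theorem hasDerivAt_linear (h : IsGraphChart Z z θ₀ θ₁ c r) (φ : V →ₗ[ℂ] ℂ) {t : ℂ}
    (ht : t ∈ Metric.ball (0 : ℂ) r) : HasDerivAt (fun t => φ (c t)) (φ (deriv c t)) t :=
  h.hasDerivAt_comp (LinearMap.toContinuousLinearMap φ) ht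

/-- In the eigenbasis with eigenvalues `g(p) + i`, suitably scaled, the coordinates of the curve
are `(t - p) ^ i` to leading order. -/
theorem exists_scaled_eigenbasis (h : IsGraphChart Z z θ₀ θ₁ c r)
    (hV : Module.finrank ℂ V = 4) {σ : LinearMap.BilinForm ℂ V} (hσ : σ.IsAlt)
    (hσn : σ.Nondegenerate) (hleg : IsLegendrian σ Z) {p : ℂ}
    (hp : p ∈ Metric.ball (0 : ℂ) r) (h2 : deriv (deriv c) p ≠ 0) {u : Module.End ℂ V}
    (hu : u ∈ autGerm σ Z z) (hf : inducedField θ₀ θ₁ c u p = 0)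
    (hf' : deriv (inducedField θ₀ θ₁ c u) p = 1) :
    ∃ (e : Module.Basis (Fin 4) ℂ V) (R : Fin 4 → ℂ → ℂ),
      (∀ i : Fin 4, u (e i) = (θ₀ (u (c p)) + (i : ℕ)) • e i) ∧
      ∀ i : Fin 4, AnalyticAt ℂ (R i) p ∧ R i p = 1 ∧
        ∀ᶠ t in 𝓝 p, e.coord i (c t) = (t - p) ^ (i : ℕ) * R i t := by
  obtain ⟨e, he⟩ := h.exists_eigenbasis hV hσ hσn hleg hp h2 hu hf hf'
  have key : ∀ i : Fin 4, ∃ R : ℂ → ℂ, AnalyticAt ℂ R p ∧ R p ≠ 0 ∧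
      ∀ᶠ t in 𝓝 p, e.coord i (c t) = (t - p) ^ (i : ℕ) * R t := by
    intro i
    have hne : ¬ ∀ᶠ t in 𝓝 p, e.coord i (c t) = 0 := by
      intro h0
      have h3 := h.linearMap_eq_zero hV hσ hσn hleg hp h2
        (LinearMap.toContinuousLinearMap (e.coord i)) h0
      have h4 := congr($h3 (e i))
      simp at h4
    obtain ⟨n, R, hR, hRp, hnR⟩ :=
      (h.analytic_apply (e.coord i) p hp).exists_eventuallyEq_pow_smul_nonzero_iff.2 hne
    have h5 := natCast_mul_deriv_eq_of_mul_deriv_eq (h.analytic_inducedField u p hp)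
      (m := fun t => θ₀ (u (c p)) + (i : ℕ) - θ₀ (u (c t)))
      (analyticAt_const.sub (h.analytic_fst_apply u p hp)).continuousAt hR hRp
      (by simpa only [smul_eq_mul] using hnR) hf
      (by
        filter_upwards [ball_mem_nhds hp] with t ht
        rw [(h.hasDerivAt_linear (e.coord i) ht).deriv]
        exact h.mul_coord_deriv_eq hu (l := fun i : Fin 4 => θ₀ (u (c p)) + (i : ℕ)) he i ht)
    have hn : n = (i : ℕ) := by
      rw [hf', mul_one] at h5
      have : (n : ℂ) = ((i : ℕ) : ℂ) := by linear_combination h5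
      exact_mod_cast this
    subst hn
    exact ⟨R, hR, hRp, by simpa only [smul_eq_mul] using hnR⟩
  choose R hR hRp hRe using key
  refine ⟨e.unitsSMul fun i => Units.mk0 (R i p) (hRp i), fun i t => (R i p)⁻¹ * R i t,
    fun i => ?_, fun i => ⟨analyticAt_const.mul (hR i), inv_mul_cancel₀ (hRp i), ?_⟩⟩
  · rw [Module.Basis.unitsSMul_apply, Units.smul_def, map_smul, he, smul_comm]
  · filter_upwards [hRe i] with t ht
    rw [Module.Basis.coord_unitsSMul]
    simp only [LinearMap.smul_apply, Units.smul_def, Units.val_inv_eq_inv_val, Units.val_mk0,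
      smul_eq_mul, ht]
    ring

/-- The coordinates satisfy the quadratic equations of the twisted cubic: both sides solve the
same equation `f Q' = m Q` with exponent `i + j`, and they agree to leading order. -/
theorem coord_mul_coord_eq (h : IsGraphChart Z z θ₀ θ₁ c r) {σ : LinearMap.BilinForm ℂ V} {p : ℂ}
    (hp : p ∈ Metric.ball (0 : ℂ) r) {u : Module.End ℂ V}
    (hu : u ∈ autGerm σ Z z) (hf : inducedField θ₀ θ₁ c u p = 0)
    (hf' : deriv (inducedField θ₀ θ₁ c u) p = 1)
    {e : Module.Basis (Fin 4) ℂ V} {R : Fin 4 → ℂ → ℂ}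
    (he : ∀ i : Fin 4, u (e i) = (θ₀ (u (c p)) + (i : ℕ)) • e i)
    (hR : ∀ i : Fin 4, AnalyticAt ℂ (R i) p ∧ R i p = 1 ∧
        ∀ᶠ t in 𝓝 p, e.coord i (c t) = (t - p) ^ (i : ℕ) * R i t)
    {i j k m : Fin 4} (hijk : (i : ℕ) + j = k + m) {t : ℂ} (ht : t ∈ Metric.ball (0 : ℂ) r) :
    e.coord i (c t) * e.coord j (c t) = e.coord k (c t) * e.coord m (c t) := by
  have hA := fun i => h.analytic_apply (e.coord i)
  have hQ : ∀ᶠ t in 𝓝 p,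
      e.coord i (c t) * e.coord j (c t) - e.coord k (c t) * e.coord m (c t) = 0 := by
    refine eventually_eq_zero_of_mul_deriv_eq (n := (i : ℕ) + j)
      (h.analytic_inducedField u p hp)
      (m := fun t => 2 * θ₀ (u (c p)) + (i : ℕ) + (j : ℕ) - 2 * θ₀ (u (c t)))
      (R := fun t => R i t * R j t - R k t * R m t)
      (analyticAt_const.sub (analyticAt_const.mul (h.analytic_fst_apply u p hp))).continuousAt
      (((hR i).1.mul (hR j).1).sub ((hR k).1.mul (hR m).1))
      (by simp [(hR i).2.1, (hR j).2.1, (hR k).2.1, (hR m).2.1]) ?_ hf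
      (by rw [hf']; exact one_ne_zero) (by rw [hf']; push_cast; ring) ?_
    · filter_upwards [(hR i).2.2, (hR j).2.2, (hR k).2.2, (hR m).2.2] with t h1 h2 h3 h4
      rw [h1, h2, h3, h4, mul_sub, pow_add]
      have : (t - p) ^ (i : ℕ) * (t - p) ^ (j : ℕ) = (t - p) ^ (k : ℕ) * (t - p) ^ (m : ℕ) := by
        rw [← pow_add, ← pow_add, hijk]
      linear_combination (R k t * R m t) * this
    · filter_upwards [ball_mem_nhds hp] with t ht
      have hd := fun i => h.hasDerivAt_linear (e.coord i) ht
      have hc := fun i => h.mul_coord_deriv_eq hu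
        (l := fun i : Fin 4 => θ₀ (u (c p)) + (i : ℕ)) he i ht
      rw [(((hd i).fun_mul (hd j)).fun_sub ((hd k).fun_mul (hd m))).deriv]
      have hcast : ((i : ℕ) : ℂ) + (j : ℕ) = (k : ℕ) + (m : ℕ) := by exact_mod_cast hijk
      linear_combination e.coord j (c t) * hc i + e.coord i (c t) * hc j -
        e.coord m (c t) * hc k - e.coord k (c t) * hc m +
        (e.coord k (c t) * e.coord m (c t)) * hcast
  exact AnalyticOnNhd.eqOn_of_preconnected_of_eventuallyEq
    (fun t ht => (hA i t ht).mul (hA j t ht)) (fun t ht => (hA k t ht).mul (hA m t ht))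
    (isPreconnected_ball r) hp (hQ.mono fun t ht => sub_eq_zero.1 ht) ht

end IsGraphChart

/-! ### The symplectic form in an eigenbasis -/

/-- In an eigenbasis of an element of `csp(V)` with eigenvalues `l`, `l + 1`, `l + 2`, `l + 3`,
the symplectic form pairs the basis vectors with complementary indices. -/
theorem exists_antidiagonal {V : Type*} [AddCommGroup V] [Module ℂ V]
    {σ : LinearMap.BilinForm ℂ V} (hσ : σ.IsAlt)
    (hσn : σ.Nondegenerate) {u : Module.End ℂ V} {κ : ℂ}
    (hu : ∀ v w, σ (u v) w + σ v (u w) = κ * σ v w) {e : Module.Basis (Fin 4) ℂ V} {l : ℂ}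
    (he : ∀ i : Fin 4, u (e i) = (l + (i : ℕ)) • e i) :
    ∃ A B : ℂ, A ≠ 0 ∧ ∀ v w, σ v w =
      A * (e.coord 0 v * e.coord 3 w - e.coord 3 v * e.coord 0 w) +
      B * (e.coord 1 v * e.coord 2 w - e.coord 2 v * e.coord 1 w) := by
  have hz : ∀ i j : Fin 4, (2 * l + (i : ℕ) + (j : ℕ) - κ) * σ (e i) (e j) = 0 := by
    intro i j
    have := hu (e i) (e j)
    rw [he, he, map_smul, map_smul, LinearMap.smul_apply, smul_eq_mul, smul_eq_mul] at this
    linear_combination this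
  have hex : ∀ i, ∃ j, σ (e i) (e j) ≠ 0 := by
    intro i
    by_contra! hcon
    refine e.ne_zero i (hσn.1 _ fun w => ?_)
    exact LinearMap.congr_fun (e.ext (f₁ := σ (e i)) (f₂ := 0) (by simpa using hcon)) w
  -- Both `e 0` and `e 3` pair nontrivially with some basis vector, which forces `κ = 2 l + 3`.
  obtain ⟨j, hj⟩ := hex 0
  obtain ⟨k, hk⟩ := hex 3
  have hj' := (mul_eq_zero.1 (hz 0 j)).resolve_right hj
  have hk' := (mul_eq_zero.1 (hz 3 k)).resolve_right hk
  have v3 : ((3 : Fin 4) : ℕ) = 3 := rfl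
  have hjk : (j : ℕ) = 3 + k := by
    have : ((j : ℕ) : ℂ) = 3 + (k : ℕ) := by
      simp only [Fin.val_zero, Nat.cast_zero, v3, Nat.cast_ofNat] at hj' hk'
      linear_combination hj' - hk'
    exact_mod_cast this
  have hj3 : j = 3 := Fin.ext (by rw [v3]; omega)
  subst hj3
  have hκ : κ = 2 * l + 3 := by
    simp only [Fin.val_zero, Nat.cast_zero, v3, Nat.cast_ofNat] at hj'
    linear_combination -hj'
  have hz' : ∀ i j : Fin 4, (i : ℕ) + j ≠ 3 → σ (e i) (e j) = 0 := by
    intro i j hij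
    refine (mul_eq_zero.1 (hz i j)).resolve_left fun h0 => hij ?_
    have : ((i : ℕ) : ℂ) + (j : ℕ) = 3 := by rw [hκ] at h0; linear_combination h0
    exact_mod_cast this
  have h30 : σ (e 3) (e 0) = -σ (e 0) (e 3) := (hσ.neg_eq _ _).symm
  have h21 : σ (e 2) (e 1) = -σ (e 1) (e 2) := (hσ.neg_eq _ _).symm
  refine ⟨σ (e 0) (e 3), σ (e 1) (e 2), hj, fun v w => ?_⟩
  conv_lhs => rw [← e.sum_repr v, ← e.sum_repr w]
  simp only [Fin.sum_univ_four, map_add, map_smul, LinearMap.add_apply, LinearMap.smul_apply,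
    smul_eq_mul, h30, h21, hz' 0 0 (by decide), hz' 0 1 (by decide), hz' 0 2 (by decide),
    hz' 1 0 (by decide), hz' 1 1 (by decide), hz' 1 3 (by decide), hz' 2 0 (by decide),
    hz' 2 2 (by decide), hz' 2 3 (by decide), hz' 3 1 (by decide), hz' 3 2 (by decide),
    hz' 3 3 (by decide), Module.Basis.coord_apply]
  ring

namespace IsGraphChart

variable {Z : Set (ℙ ℂ V)} {z : V} {θ₀ θ₁ : V →L[ℂ] ℂ} {c : ℂ → V} {r : ℝ}
  [FiniteDimensional ℂ V]

/-- The leading term of `σ(c, c') = 0` determines the ratio of the two symplectic invariants. -/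
theorem eq_neg_three_mul (h : IsGraphChart Z z θ₀ θ₁ c r) {σ : LinearMap.BilinForm ℂ V}
    (hleg : IsLegendrian σ Z) {p : ℂ} (hp : p ∈ Metric.ball (0 : ℂ) r)
    {e : Module.Basis (Fin 4) ℂ V} {R : Fin 4 → ℂ → ℂ}
    (hR : ∀ i : Fin 4, AnalyticAt ℂ (R i) p ∧ R i p = 1 ∧
        ∀ᶠ t in 𝓝 p, e.coord i (c t) = (t - p) ^ (i : ℕ) * R i t) {A B : ℂ}
    (hAB : ∀ v w, σ v w = A * (e.coord 0 v * e.coord 3 w - e.coord 3 v * e.coord 0 w) +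
      B * (e.coord 1 v * e.coord 2 w - e.coord 2 v * e.coord 1 w)) : B = -3 * A := by
  have key := eq_zero_of_eventually_pow_mul (p := p) (E := fun t =>
    A * (R 0 t * (3 * R 3 t + (t - p) * deriv (R 3) t) - (t - p) * R 3 t * deriv (R 0) t) +
    B * (R 1 t * (2 * R 2 t + (t - p) * deriv (R 2) t)
      - R 2 t * (R 1 t + (t - p) * deriv (R 1) t))) 2 ?_ ?_
  · simp only [(hR _).2.1, sub_self, zero_mul] at key
    linear_combination key
  · have hc := fun i => (hR i).1.continuousAt
    have hd := fun i => (hR i).1.deriv.continuousAt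
    have h0 := hc 0
    have h1 := hc 1
    have h2 := hc 2
    have h3 := hc 3
    have h0' := hd 0
    have h1' := hd 1
    have h2' := hd 2
    have h3' := hd 3
    fun_prop
  · have hev : ∀ i : Fin 4, ∀ᶠ t in 𝓝 p, e.coord i (c t) = (t - p) ^ (i : ℕ) * R i t ∧
        e.coord i (deriv c t) = (i : ℕ) * (t - p) ^ ((i : ℕ) - 1) * R i t +
          (t - p) ^ (i : ℕ) * deriv (R i) t := by
      intro i
      filter_upwards [(hR i).2.2.eventually_nhds, (hR i).1.eventually_analyticAt,
        ball_mem_nhds hp] with t h1 h2 h3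
      refine ⟨h1.self_of_nhds, (h.hasDerivAt_linear (e.coord i) h3).unique ?_⟩
      exact (hasDerivAt_pow_sub_mul (i : ℕ) h2.differentiableAt).congr_of_eventuallyEq h1
    filter_upwards [hev 0, hev 1, hev 2, hev 3, ball_mem_nhds hp] with t h0 h1 h2 h3 ht
    have := h.bilin_deriv_eq_zero hleg ht
    rw [hAB, h0.1, h0.2, h1.1, h1.2, h2.1, h2.2, h3.1, h3.2] at this
    have v3 : ((3 : Fin 4) : ℕ) = 3 := rfl
    simp only [Fin.val_zero, Fin.val_one, Fin.val_two, v3, Nat.cast_zero, Nat.cast_one,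
      Nat.cast_ofNat, pow_zero, Nat.reduceSub, pow_one] at this
    linear_combination this

/-- Symplectic coordinates in which the curve lies on the cone over the twisted cubic. -/
theorem exists_symplectic_equiv (h : IsGraphChart Z z θ₀ θ₁ c r)
    (hV : Module.finrank ℂ V = 4) {σ : LinearMap.BilinForm ℂ V} (hσ : σ.IsAlt)
    (hσn : σ.Nondegenerate) (hleg : IsLegendrian σ Z) (hnd : IsNondegenerateGerm Z z)
    (hdim : 3 ≤ Module.finrank ℂ (autGerm σ Z z)) :
    ∃ f : V ≃ₗ[ℂ] (Fin 4 → ℂ), (∀ v w, cubicForm (f v) (f w) = σ v w) ∧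
      ∀ t ∈ Metric.ball (0 : ℂ) r, f (c t) 0 * f (c t) 2 = f (c t) 1 ^ 2 ∧
        f (c t) 1 * f (c t) 3 = f (c t) 2 ^ 2 ∧
        f (c t) 0 * f (c t) 3 = f (c t) 1 * f (c t) 2 := by
  obtain ⟨p, hp, h2, u, hu, hf, hf'⟩ := h.exists_simple_zero hV hσ hσn hleg hnd hdim
  obtain ⟨e, R, he, hR⟩ := h.exists_scaled_eigenbasis hV hσ hσn hleg hp h2 hu hf hf'
  obtain ⟨κ, hκ⟩ := hu.1
  obtain ⟨A, B, hA, hAB⟩ := exists_antidiagonal hσ hσn hκ he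
  have hB := h.eq_neg_three_mul hleg hp hR hAB
  obtain ⟨a, ha⟩ := IsAlgClosed.exists_pow_nat_eq A (n := 2) two_pos
  have ha0 : a ≠ 0 := by
    rintro rfl
    exact hA (by simpa using ha.symm)
  have hq := fun {i j k m : Fin 4} (hijk : (i : ℕ) + j = k + m) {t : ℂ} ht =>
    h.coord_mul_coord_eq hp hu hf hf' he hR hijk (t := t) ht
  refine ⟨e.equivFun.trans (LinearEquiv.smulOfNeZero ℂ (Fin 4 → ℂ) a ha0), fun v w => ?_,
    fun t ht => ?_⟩
  · rw [hAB, hB, ← ha]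
    simp [cubicForm]
    ring
  · have q1 := hq (i := 0) (j := 2) (k := 1) (m := 1) rfl ht
    have q2 := hq (i := 1) (j := 3) (k := 2) (m := 2) rfl ht
    have q3 := hq (i := 0) (j := 3) (k := 1) (m := 2) rfl ht
    simp only [Module.Basis.coord_apply] at q1 q2 q3
    simp only [LinearEquiv.trans_apply, LinearEquiv.smulOfNeZero_apply, Pi.smul_apply,
      Module.Basis.equivFun_apply, smul_eq_mul]
    refine ⟨?_, ?_, ?_⟩
    · linear_combination a ^ 2 * q1
    · linear_combination a ^ 2 * q2
    · linear_combination a ^ 2 * q3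

end IsGraphChart

/-! ### The twisted cubic and its stabilizer -/

theorem cube_ne_zero (x : ℂ) : cube 1 x ≠ 0 := fun h => by
  simpa [cube] using congr_fun h 0

theorem mem_affineCone_rationalNormalCurve {v : Fin 4 → ℂ} (hv : v 0 ≠ 0) :
    v ∈ affineCone rationalNormalCurve ↔ v = v 0 • cube 1 (v 1 / v 0) := by
  constructor
  · rintro ⟨q, ⟨a, b, hab, rfl⟩, hvq⟩
    rw [Projectivization.submodule_mk, Submodule.mem_span_singleton] at hvq
    obtain ⟨s, rfl⟩ := hvq
    have hs : s ≠ 0 := by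
      rintro rfl
      simp at hv
    have ha : a ≠ 0 := by
      rintro rfl
      simp [cube] at hv
    funext i
    fin_cases i <;> simp [cube] <;> field_simp
  · intro h
    refine ⟨Projectivization.mk ℂ _ (cube_ne_zero (v 1 / v 0)), ⟨1, v 1 / v 0, cube_ne_zero _, rfl⟩,
      ?_⟩
    rw [Projectivization.submodule_mk, Submodule.mem_span_singleton]
    exact ⟨v 0, h.symm⟩

theorem eq_smul_cube {v : Fin 4 → ℂ} (hv : v 0 ≠ 0) (h1 : v 0 * v 2 = v 1 ^ 2)
    (h2 : v 0 * v 3 = v 1 * v 2) : v = v 0 • cube 1 (v 1 / v 0) := by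
  funext i
  fin_cases i
  · simp [cube]
  · simp [cube]
    field_simp
  · simp [cube]
    field_simp
    linear_combination h1
  · simp [cube]
    field_simp
    linear_combination v 0 * h2 + v 1 * h1

/-- The symplectic map of `Sym³ ℂ²` induced by `(a, b) ↦ (b, -a)`. -/
def cubicFlip : (Fin 4 → ℂ) ≃ₗ[ℂ] (Fin 4 → ℂ) where
  toFun v := ![v 3, -v 2, v 1, -v 0]
  invFun v := ![-v 3, v 2, -v 1, v 0]
  map_add' v w := by
    funext i
    fin_cases i <;> simp <;> ring
  map_smul' s v := by
    funext i
    fin_cases i <;> simp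
  left_inv v := by
    funext i
    fin_cases i <;> simp
  right_inv v := by
    funext i
    fin_cases i <;> simp

/-- The velocity of the curve `x ↦ cube 1 x`. -/
def cubeDeriv (x : ℂ) : Fin 4 → ℂ :=
  ![0, 1, 2 * x, 3 * x ^ 2]

theorem hasDerivAt_cube (x : ℂ) : HasDerivAt (cube 1) (cubeDeriv x) x := by
  rw [hasDerivAt_pi]
  intro i
  fin_cases i
  · simpa [cube, cubeDeriv] using hasDerivAt_const x (1 : ℂ)
  · simpa [cube, cubeDeriv] using hasDerivAt_id' x
  · simpa [cube, cubeDeriv] using hasDerivAt_pow 2 x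
  · simpa [cube, cubeDeriv] using hasDerivAt_pow 3 x

/-- The action of `gl₂` on `Sym³ ℂ²`: the matrix with rows `(q 0, q 1)` and `(q 2, q 3)` moves
`cube a b` with the velocity induced by `a' = q 0 a + q 1 b`, `b' = q 2 a + q 3 b`. -/
def cubicAction : (Fin 4 → ℂ) →ₗ[ℂ] Module.End ℂ (Fin 4 → ℂ) :=
  LinearMap.mk₂ ℂ
    (fun q v => ![3 * q 0 * v 0 + 3 * q 1 * v 1,
      q 2 * v 0 + (2 * q 0 + q 3) * v 1 + 2 * q 1 * v 2,
      2 * q 2 * v 1 + (q 0 + 2 * q 3) * v 2 + q 1 * v 3,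
      3 * q 2 * v 2 + 3 * q 3 * v 3])
    (by intro q q' v; funext i; fin_cases i <;> simp <;> ring)
    (by intro s q v; funext i; fin_cases i <;> simp <;> ring)
    (by intro q v v'; funext i; fin_cases i <;> simp <;> ring)
    (by intro s q v; funext i; fin_cases i <;> simp <;> ring)

theorem cubicAction_injective : Function.Injective cubicAction := by
  rw [injective_iff_map_eq_zero]
  intro q hq
  have h := fun v i => congr_fun (LinearMap.congr_fun hq v) i
  funext i
  fin_cases i
  · simpa [cubicAction] using h (Pi.single 0 1) 0
  · simpa [cubicAction] using h (Pi.single 1 1) 0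
  · simpa [cubicAction] using h (Pi.single 0 1) 1
  · simpa [cubicAction] using h (Pi.single 3 1) 3

theorem cubicAction_cube (q : Fin 4 → ℂ) (x : ℂ) :
    cubicAction q (cube 1 x) = (3 * q 0 + 3 * q 1 * x) • cube 1 x +
      (q 2 + (q 3 - q 0) * x - q 1 * x ^ 2) • cubeDeriv x := by
  funext i
  fin_cases i <;> simp [cubicAction, cube, cubeDeriv] <;> ring

theorem cubicForm_cubicAction (q v w : Fin 4 → ℂ) :
    cubicForm (cubicAction q v) w + cubicForm v (cubicAction q w) =
      3 * (q 0 + q 3) * cubicForm v w := by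
  simp [cubicForm, cubicAction]
  ring

theorem eq_zero_of_eventually_sum_mul_pow {n : ℕ} {a : Fin n → ℂ} {x₀ : ℂ}
    (h : ∀ᶠ x in 𝓝 x₀, ∑ i, a i * x ^ (i : ℕ) = 0) : a = 0 := by
  have hp : (∑ i, Polynomial.C (a i) * Polynomial.X ^ (i : ℕ) : Polynomial ℂ) = 0 := by
    refine Polynomial.eq_zero_of_infinite_isRoot _ ((infinite_of_mem_nhds x₀ h).mono fun x hx => ?_)
    simpa [Polynomial.IsRoot, Polynomial.eval_finsetSum] using hx
  funext j
  have := congr(Polynomial.coeff $hp (j : ℕ))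
  simpa [Polynomial.finsetSum_coeff, Polynomial.coeff_X_pow, Fin.val_inj] using this

/-- A linear map that is tangent to the twisted cubic along an open piece comes from `gl₂`: the
tangency is a pair of polynomial identities in the parameter, whose coefficients determine the
matrix. -/
theorem exists_eq_cubicAction {m : Module.End ℂ (Fin 4 → ℂ)} {x₀ : ℂ}
    (h : ∀ᶠ x in 𝓝 x₀, ∃ a b : ℂ, m (cube 1 x) = a • cube 1 x + b • cubeDeriv x) :
    ∃ q, cubicAction q = m := by
  obtain ⟨M, hM⟩ : ∃ M : Fin 4 → Fin 4 → ℂ, ∀ v i, m v i = M i 0 * v 0 + M i 1 * v 1 +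
      M i 2 * v 2 + M i 3 * v 3 := by
    refine ⟨fun i j => m (Pi.single j 1) i, fun v i => ?_⟩
    rw [LinearMap.pi_apply_eq_sum_univ m v]
    simp only [Fin.sum_univ_four, Pi.add_apply, Pi.smul_apply, smul_eq_mul]
    have hs : ∀ j : Fin 4, (fun k => if j = k then (1 : ℂ) else 0) = Pi.single j 1 := by
      intro j
      funext k
      simp [Pi.single_apply, eq_comm]
    simp only [hs]
    ring
  have hw : ∀ᶠ x in 𝓝 x₀, m (cube 1 x) 2 - 2 * x * m (cube 1 x) 1 + x ^ 2 * m (cube 1 x) 0 = 0 ∧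
      m (cube 1 x) 3 - 3 * x ^ 2 * m (cube 1 x) 1 + 2 * x ^ 3 * m (cube 1 x) 0 = 0 := by
    filter_upwards [h] with x ⟨a, b, hab⟩
    rw [hab]
    constructor <;> simp [cube, cubeDeriv] <;> ring
  have h1 := eq_zero_of_eventually_sum_mul_pow (x₀ := x₀) (a := ![M 2 0, M 2 1 - 2 * M 1 0,
    M 2 2 - 2 * M 1 1 + M 0 0, M 2 3 - 2 * M 1 2 + M 0 1, -2 * M 1 3 + M 0 2, M 0 3]) (by
      filter_upwards [hw] with x hx
      have := hx.1
      simp only [hM, cube, Matrix.cons_val] at this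
      simp [Fin.sum_univ_succ]
      linear_combination this)
  have h2 := eq_zero_of_eventually_sum_mul_pow (x₀ := x₀) (a := ![M 3 0, M 3 1, M 3 2 - 3 * M 1 0,
    M 3 3 - 3 * M 1 1 + 2 * M 0 0, -3 * M 1 2 + 2 * M 0 1, -3 * M 1 3 + 2 * M 0 2,
    2 * M 0 3]) (by
      filter_upwards [hw] with x hx
      have := hx.2
      simp only [hM, cube, Matrix.cons_val] at this
      simp [Fin.sum_univ_succ]
      linear_combination this)
  have a0 : M 2 0 = 0 := congr_fun h1 0
  have a1 : M 2 1 - 2 * M 1 0 = 0 := congr_fun h1 1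
  have a2 : M 2 2 - 2 * M 1 1 + M 0 0 = 0 := congr_fun h1 2
  have a3 : M 2 3 - 2 * M 1 2 + M 0 1 = 0 := congr_fun h1 3
  have a4 : -2 * M 1 3 + M 0 2 = 0 := congr_fun h1 4
  have a5 : M 0 3 = 0 := congr_fun h1 5
  have b0 : M 3 0 = 0 := congr_fun h2 0
  have b1 : M 3 1 = 0 := congr_fun h2 1
  have b2 : M 3 2 - 3 * M 1 0 = 0 := congr_fun h2 2
  have b3 : M 3 3 - 3 * M 1 1 + 2 * M 0 0 = 0 := congr_fun h2 3
  have b4 : -3 * M 1 2 + 2 * M 0 1 = 0 := congr_fun h2 4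
  have b5 : -3 * M 1 3 + 2 * M 0 2 = 0 := congr_fun h2 5
  refine ⟨![M 0 0 / 3, M 0 1 / 3, M 1 0, M 1 1 - 2 * (M 0 0 / 3)], LinearMap.ext fun v => ?_⟩
  funext i
  rw [hM]
  fin_cases i
  · simp [cubicAction]
    linear_combination (3 * a4 - 2 * b5) * v 2 - a5 * v 3
  · simp [cubicAction]
    linear_combination (2 * a4 - b5) * v 3 + (b4 / 3) * v 2
  · simp [cubicAction]
    linear_combination (-a0) * v 0 - a1 * v 1 - a2 * v 2 - (a3 - 2 / 3 * b4) * v 3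
  · simp [cubicAction]
    linear_combination (-b0) * v 0 - b1 * v 1 - b2 * v 2 - b3 * v 3

/-! ### The germ of the curve and its algebra -/

namespace IsGraphChart

variable {Z : Set (ℙ ℂ V)} {z : V} {θ₀ θ₁ : V →L[ℂ] ℂ} {c : ℂ → V} {r : ℝ}
  [FiniteDimensional ℂ V]

/-- The symplectic coordinates can be chosen so that `[z]` is not at infinity on the twisted
cubic. -/
theorem exists_symplectic_equiv_normalized (h : IsGraphChart Z z θ₀ θ₁ c r)
    (hV : Module.finrank ℂ V = 4) {σ : LinearMap.BilinForm ℂ V} (hσ : σ.IsAlt)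
    (hσn : σ.Nondegenerate) (hleg : IsLegendrian σ Z) (hnd : IsNondegenerateGerm Z z)
    (hdim : 3 ≤ Module.finrank ℂ (autGerm σ Z z)) :
    ∃ f : V ≃ₗ[ℂ] (Fin 4 → ℂ), (∀ v w, cubicForm (f v) (f w) = σ v w) ∧ f z 0 ≠ 0 ∧
      ∀ t ∈ Metric.ball (0 : ℂ) r, f (c t) 0 * f (c t) 2 = f (c t) 1 ^ 2 ∧
        f (c t) 0 * f (c t) 3 = f (c t) 1 * f (c t) 2 := by
  obtain ⟨f, hf, hq⟩ := h.exists_symplectic_equiv hV hσ hσn hleg hnd hdim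
  by_cases h0 : f z 0 = 0
  -- The only point of the twisted cubic with `f z 0 = 0` is `[0 : 0 : 0 : 1]`, which the flip moves.
  · refine ⟨f.trans cubicFlip, fun v w => ?_, ?_, fun t ht => ?_⟩
    · rw [← hf]
      simp [cubicForm, cubicFlip]
      ring
    · have hz := hq 0 h.zero_mem
      rw [h.curve_zero, h0] at hz
      have h1 : f z 1 = 0 := by simpa using hz.1.symm
      have h2 : f z 2 = 0 := by simpa [h1] using hz.2.1.symm
      intro h3
      have h3' : f z 3 = 0 := by simpa [cubicFlip] using h3
      have : f z = 0 := by
        funext i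
        fin_cases i
        exacts [h0, h1, h2, h3']
      have hz0 := h.fst_base
      rw [f.map_eq_zero_iff.1 this, map_zero] at hz0
      exact zero_ne_one hz0
    · obtain ⟨-, q2, q3⟩ := hq t ht
      simp only [LinearEquiv.trans_apply, cubicFlip, LinearEquiv.coe_mk, LinearMap.coe_mk,
        AddHom.coe_mk, Matrix.cons_val]
      exact ⟨by linear_combination q2, by linear_combination -q3⟩
  · exact ⟨f, hf, h0, fun t ht => ⟨(hq t ht).1, (hq t ht).2.2⟩⟩

/-- A curve on the cone over the twisted cubic, away from the point at infinity, in the affine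
parameter `H` of the twisted cubic. Since the curve is immersed, `H` is a local coordinate. -/
theorem eventually_cube_param (h : IsGraphChart Z z θ₀ θ₁ c r) (f : V ≃ₗ[ℂ] (Fin 4 → ℂ))
    (hz : f z 0 ≠ 0)
    (hq : ∀ t ∈ Metric.ball (0 : ℂ) r, f (c t) 0 * f (c t) 2 = f (c t) 1 ^ 2 ∧
        f (c t) 0 * f (c t) 3 = f (c t) 1 * f (c t) 2) :
    ∃ k H : ℂ → ℂ, AnalyticAt ℂ H 0 ∧ deriv H 0 ≠ 0 ∧ H 0 = f z 1 / f z 0 ∧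
      ∀ᶠ t in 𝓝 (0 : ℂ), k t ≠ 0 ∧ deriv H t ≠ 0 ∧ f (c t) = k t • cube 1 (H t) ∧
        f (deriv c t) = deriv k t • cube 1 (H t) + (k t * deriv H t) • cubeDeriv (H t) := by
  have hanal : ∀ i, AnalyticAt ℂ (fun t => f (c t) i) 0 := fun i =>
    h.analytic_apply (LinearMap.proj i ∘ₗ f.toLinearMap) 0 h.zero_mem
  have hk0 : f (c 0) 0 ≠ 0 := by rwa [h.curve_zero]
  let k : ℂ → ℂ := fun t => f (c t) 0
  let H : ℂ → ℂ := fun t => f (c t) 1 / f (c t) 0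
  have hk : AnalyticAt ℂ k 0 := hanal 0
  have hH : AnalyticAt ℂ H 0 := (hanal 1).div (hanal 0) hk0
  have hkne : ∀ᶠ t in 𝓝 (0 : ℂ), k t ≠ 0 := hk.continuousAt.eventually_ne hk0
  have hfc : ∀ᶠ t in 𝓝 (0 : ℂ), f (c t) = k t • cube 1 (H t) := by
    filter_upwards [hkne, ball_mem_nhds h.zero_mem] with t h1 h2
    exact eq_smul_cube h1 (hq t h2).1 (hq t h2).2
  have hev : ∀ᶠ t in 𝓝 (0 : ℂ), k t ≠ 0 ∧ deriv H t ≠ 0 ∧ f (c t) = k t • cube 1 (H t) ∧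
      f (deriv c t) = deriv k t • cube 1 (H t) + (k t * deriv H t) • cubeDeriv (H t) := by
    filter_upwards [hkne, hfc.eventually_nhds, hk.eventually_analyticAt, hH.eventually_analyticAt,
      ball_mem_nhds h.zero_mem] with t h1 h2 h3 h4 h5
    have hd : f (deriv c t) =
        deriv k t • cube 1 (H t) + (k t * deriv H t) • cubeDeriv (H t) := by
      have e1 := h.hasDerivAt_comp (LinearMap.toContinuousLinearMap f.toLinearMap) h5
      have e2 := h3.differentiableAt.hasDerivAt.fun_smul
        ((hasDerivAt_cube (H t)).scomp t h4.differentiableAt.hasDerivAt)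
      refine (e1.unique (e2.congr_of_eventuallyEq h2)).trans ?_
      rw [smul_smul, add_comm]
      rfl
    refine ⟨h1, fun hH0 => ?_, h2.self_of_nhds, hd⟩
    -- If `H' = 0`, then `c'` is proportional to `c`.
    have hrel : deriv k t • c t + (-k t) • deriv c t = 0 := by
      apply f.injective
      rw [map_add, map_smul, map_smul, map_zero, hd, hH0, h2.self_of_nhds]
      module
    exact h1 (neg_eq_zero.1 (LinearIndependent.pair_iff.1 (h.linearIndependent_deriv h5) _ _
      hrel).2)
  exact ⟨k, H, hH, hev.self_of_nhds.2.1, by simp [H, h.curve_zero], hev⟩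

/-- A curve on the cone over the twisted cubic is open in it. -/
theorem eventually_mem_affineCone_iff (h : IsGraphChart Z z θ₀ θ₁ c r) (f : V ≃ₗ[ℂ] (Fin 4 → ℂ))
    (hz : f z 0 ≠ 0) {k H : ℂ → ℂ} (hH : AnalyticAt ℂ H 0) (hH' : deriv H 0 ≠ 0)
    (hH0 : H 0 = f z 1 / f z 0)
    (hev : ∀ᶠ t in 𝓝 (0 : ℂ), k t ≠ 0 ∧ f (c t) = k t • cube 1 (H t)) :
    ∀ᶠ v in 𝓝 z, v ∈ affineCone Z ↔ f v ∈ affineCone rationalNormalCurve := by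
  have hfc : Continuous f := f.toLinearMap.continuous_of_finiteDimensional
  have hc : ∀ i, ContinuousAt (fun v => f v i) z := fun i =>
    ((continuous_apply i).comp hfc).continuousAt
  have hne : ∀ᶠ v in 𝓝 z, f v 0 ≠ 0 := (hc 0).eventually_ne hz
  have hX : Tendsto (fun v => f v 1 / f v 0) (𝓝 z) (𝓝 (H 0)) := by
    rw [hH0]
    exact ((hc 1).div (hc 0) hz).tendsto
  have himg : ∀ᶠ x in 𝓝 (H 0), ∃ t, (k t ≠ 0 ∧ f (c t) = k t • cube 1 (H t)) ∧
      t ∈ Metric.ball (0 : ℂ) r ∧ H t = x := by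
    rw [← hH.hasStrictDerivAt.map_nhds_eq hH', eventually_map]
    filter_upwards [hev, ball_mem_nhds h.zero_mem] with t h1 h2 using ⟨t, h1, h2, rfl⟩
  filter_upwards [h.repr, h.tendsto_param.eventually hev, hne, hX.eventually himg]
    with v hv hpar hv0 ⟨t, ⟨hkt, hft⟩, htb, hHt⟩
  constructor
  · intro hvC
    have hfv : f v = θ₀ v • f (c (θ₁ v / θ₀ v)) := by rw [← map_smul, ← hv hvC]
    rw [hfv, hpar.2]
    refine smul_mem_affineCone (smul_mem_affineCone ?_ _) _
    refine (mem_affineCone_rationalNormalCurve (by simp [cube])).2 ?_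
    simp [cube]
  · intro hfv
    rw [mem_affineCone_rationalNormalCurve hv0, ← hHt] at hfv
    have : v = (f v 0 / k t) • c t := by
      apply f.injective
      rw [map_smul, hft, smul_smul, div_mul_cancel₀ _ hkt]
      exact hfv
    rw [this]
    exact smul_mem_affineCone (h.mem t htb) _

/-- The algebra of a germ of the twisted cubic is `gl₂`. -/
theorem autGerm_eq_range (h : IsGraphChart Z z θ₀ θ₁ c r) {σ : LinearMap.BilinForm ℂ V}
    (f : V ≃ₗ[ℂ] (Fin 4 → ℂ)) (hf : ∀ v w, cubicForm (f v) (f w) = σ v w)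
    {k H : ℂ → ℂ} (hH : AnalyticAt ℂ H 0) (hH' : deriv H 0 ≠ 0)
    (hev : ∀ᶠ t in 𝓝 (0 : ℂ), k t ≠ 0 ∧ deriv H t ≠ 0 ∧ f (c t) = k t • cube 1 (H t) ∧
        f (deriv c t) = deriv k t • cube 1 (H t) + (k t * deriv H t) • cubeDeriv (H t)) :
    autGerm σ Z z = LinearMap.range (f.symm.conj.toLinearMap ∘ₗ cubicAction) := by
  ext u
  rw [LinearMap.mem_range]
  constructor
  · intro hu
    obtain ⟨q, hq⟩ := exists_eq_cubicAction (m := f.conj u) (x₀ := H 0) (by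
      rw [← hH.hasStrictDerivAt.map_nhds_eq hH', eventually_map]
      filter_upwards [hev, ball_mem_nhds h.zero_mem] with t ⟨hk, _, h1, h2⟩ ht
      have hcube : cube 1 (H t) = f ((k t)⁻¹ • c t) := by
        rw [map_smul, h1, smul_smul, inv_mul_cancel₀ hk, one_smul]
      have hu' := congr(f $(h.apply_eq hu ht))
      rw [map_add, map_smul, map_smul, h1, h2] at hu'
      refine ⟨(k t)⁻¹ * (θ₀ (u (c t)) * k t + inducedField θ₀ θ₁ c u t * deriv k t),
        (k t)⁻¹ * (inducedField θ₀ θ₁ c u t * (k t * deriv H t)), ?_⟩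
      rw [LinearEquiv.conj_apply_apply]
      conv_lhs => rw [hcube, f.symm_apply_apply, map_smul, map_smul, hu']
      module)
    refine ⟨q, ?_⟩
    rw [LinearMap.comp_apply, hq]
    ext v
    simp
  · rintro ⟨q, rfl⟩
    set u : Module.End ℂ V := (f.symm.conj.toLinearMap ∘ₗ cubicAction) q
    have hu : ∀ v, f (u v) = cubicAction q (f v) := by
      intro v
      simp [u]
    refine ⟨⟨3 * (q 0 + q 3), fun v w => ?_⟩, ?_⟩
    · rw [← hf, ← hf, ← hf, hu, hu]
      exact cubicForm_cubicAction q _ _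
    · filter_upwards [h.repr, h.eventually_tangentSpace_eq, h.tendsto_param.eventually hev]
        with v hv hT ⟨hk, hHd, h1, h2⟩ hvC
      rw [hT hvC]
      have huv : u v = θ₀ v • u (c (θ₁ v / θ₀ v)) := by
        conv_lhs => rw [hv hvC, map_smul]
      rw [huv]
      refine Submodule.smul_mem _ _ ?_
      set t := θ₁ v / θ₀ v
      set A := 3 * q 0 + 3 * q 1 * H t
      set B := q 2 + (q 3 - q 0) * H t - q 1 * H t ^ 2
      refine Submodule.mem_span_pair.2
        ⟨A - B / deriv H t * (deriv k t / k t), B / deriv H t, f.injective ?_⟩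
      rw [hu, h1, map_add, map_smul, map_smul, map_smul, cubicAction_cube, h1, h2]
      match_scalars
      · field_simp
        ring
      · field_simp
        simp only [B]
        ring

end IsGraphChart

end LegendrianCurve

end

/-- A nondegenerate Legendrian germ in `ℙ³ = ℙ V`, given as the germ at `[z]` of a Legendrian
curve `Z`, whose algebra `aut` has dimension at least `3` is isomorphic, by a linear symplectic
isomorphism, to the germ of the rational normal curve, and `aut` has dimension `4`. -/
theorem proposition7p2 {V : Type*} [NormedAddCommGroup V] [NormedSpace ℂ V]
    (hV : Module.finrank ℂ V = 4)
    (σ : LinearMap.BilinForm ℂ V) (hσ_alt : σ.IsAlt) (hσ_nondeg : σ.Nondegenerate)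
    (Z : Set (ℙ ℂ V)) (hZ_curve : LegendrianCurve.IsCurve Z)
    (hZ_leg : LegendrianCurve.IsLegendrian σ Z)
    (z : V) (hz : z ∈ LegendrianCurve.affineCone Z) (hz0 : z ≠ 0)
    (hZ_nondeg : LegendrianCurve.IsNondegenerateGerm Z z)
    (hdim : 3 ≤ Module.finrank ℂ (LegendrianCurve.autGerm σ Z z)) :
    (∃ f : V ≃ₗ[ℂ] (Fin 4 → ℂ),
      (∀ v w, LegendrianCurve.cubicForm (f v) (f w) = σ v w) ∧
      ∀ᶠ v in 𝓝 z, v ∈ LegendrianCurve.affineCone Z ↔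
        f v ∈ LegendrianCurve.affineCone LegendrianCurve.rationalNormalCurve) ∧
    Module.finrank ℂ (LegendrianCurve.autGerm σ Z z) = 4 := by
  have : FiniteDimensional ℂ V := Module.finite_of_finrank_pos (by omega)
  obtain ⟨θ₀, θ₁, c, r, h⟩ := LegendrianCurve.exists_isGraphChart hZ_curve hz hz0
  obtain ⟨f, hf, hfz, hq⟩ :=
    h.exists_symplectic_equiv_normalized hV hσ_alt hσ_nondeg hZ_leg hZ_nondeg hdim
  obtain ⟨k, H, hH, hH', hH0, hev⟩ := h.eventually_cube_param f hfz hq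
  refine ⟨⟨f, hf, h.eventually_mem_affineCone_iff f hfz hH hH' hH0
    (hev.mono fun t ht => ⟨ht.1, ht.2.2.1⟩)⟩, ?_⟩
  rw [h.autGerm_eq_range f hf hH hH' hev, LinearMap.finrank_range_of_inj]
  · simp
  · exact f.symm.conj.injective.comp LegendrianCurve.cubicAction_injective
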